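/- For $\delta\in(0,1)$ let, in polar coordinates, $$\Omega^\delta=\{(r\cos\theta,r\sin\theta)\mid \delta<r<1,\ 0<\theta<\pi\},$$ $$\Omega^\delta_+=\{(r\cos\theta,r\sin\theta)\mid \delta<r<1,\ \pi/4<\theta<\pi\},\qquad \Omega^\delta_-=\{(r\cos\theta,r\sin\theta)\mid \delta<r<1,\ 0<\theta<\pi/4\}.$$ Let $\sigma_+>0$ and $\sigma_-<0$ be constants, and let $\sigma^\delta$ be the function on $\Omega^\delta$ equal to $\sigma_\pm$ in $\Omega^\delta_\pm$. Let $H^1_0(\Omega^\delta)$ be the Sobolev space of complex-valued functions (the closure of $C_c^\infty(\Omega^\delta)$ in $H^1(\Omega^\delta)$), with the norm $\|v\|_{H^1_0(\Omega^\delta)}=\|\nabla v\|_{L^2(\Omega^\delta)}$, and let $H^{-1}(\Omega^\delta)$ be the space of continuous antilinear forms on $H^1_0(\Omega^\delta)$, with the norm $\|f\|_{H^{-1}(\Omega^\delta)}=\sup_{v\ne0}|\langle f,v\rangle|/\|v\|_{H^1_0(\Omega^\delta)}$. Let $A^\delta:H^1_0(\Omega^\delta)\to H^{-1}(\Omega^\delta)$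 be the continuous linear operator defined by $$\langle A^\delta u,v\rangle=\int_{\Omega^\delta}\sigma^\delta\,\nabla u\cdot\overline{\nabla v}\,dx,\qquad u,v\in H^1_0(\Omega^\delta).$$ Assume that $\kappa_\sigma:=\sigma_- /\sigma_+\in(-\infty,-1)\cup(-1/3,0)$. Then, for all $\delta\in(0,1)$, $A^\delta$ is an isomorphism (a linear bijection, continuous with continuous inverse). Moreover, there exists a constant $c>0$, independent of $\delta$, such that $$\|u\|_{H^1_0(\Omega^\delta)}\le c\,\|A^\delta u\|_{H^{-1}(\Omega^\delta)}\qquad\text{for all }\delta\in(0,1)\text{ and all }u\in H^1_0(\Omega^\delta).$$ -/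

import Mathlib

open MeasureTheory Set
open scoped ContDiff

noncomputable section

namespace HalfAnnulus

/-- The Euclidean plane. -/
abbrev Plane : Type := EuclideanSpace ℝ (Fin 2)

/-! ### Sobolev spaces -/

/-- `L²(Ω)`, complex valued. -/
abbrev L2 (Ω : Set Plane) : Type := Lp ℂ 2 (volume.restrict Ω)

/-- `L²(Ω)²`, complex vector fields. -/
abbrev L2Vec (Ω : Set Plane) : Type := Lp (EuclideanSpace ℂ (Fin 2)) 2 (volume.restrict Ω)

/-- The classical gradient `(∂₁φ, ∂₂φ)` of a complex valued function on the plane. -/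
def grad (φ : Plane → ℂ) (x : Plane) : EuclideanSpace ℂ (Fin 2) :=
  WithLp.toLp 2 fun i => fderiv ℝ φ x (EuclideanSpace.single i 1)

/-- `φ ∈ C_c^∞(Ω)`. -/
structure IsTestFunction (Ω : Set Plane) (φ : Plane → ℂ) : Prop where
  smooth : ContDiff ℝ ∞ φ
  compact : HasCompactSupport φ
  support : tsupport φ ⊆ Ω

theorem IsTestFunction.add {Ω : Set Plane} {φ ψ : Plane → ℂ} (hφ : IsTestFunction Ω φ)
    (hψ : IsTestFunction Ω ψ) : IsTestFunction Ω (φ + ψ) :=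
  ⟨hφ.smooth.add hψ.smooth, hφ.compact.add hψ.compact,
    (tsupport_add φ ψ).trans (union_subset hφ.support hψ.support)⟩

theorem IsTestFunction.zero (Ω : Set Plane) : IsTestFunction Ω 0 :=
  ⟨contDiff_const, HasCompactSupport.zero, by simp [tsupport]⟩

theorem IsTestFunction.smul {Ω : Set Plane} {φ : Plane → ℂ} (c : ℂ)
    (hφ : IsTestFunction Ω φ) : IsTestFunction Ω (c • φ) :=
  ⟨contDiff_const.smul hφ.smooth, hφ.compact.smul_left,
    (closure_mono (Function.support_const_smul_subset c φ)).trans hφ.support⟩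

theorem grad_add {Ω : Set Plane} {φ ψ : Plane → ℂ} (hφ : IsTestFunction Ω φ)
    (hψ : IsTestFunction Ω ψ) (x : Plane) : grad (φ + ψ) x = grad φ x + grad ψ x := by
  have h1 := hφ.smooth.differentiable (by simp) x
  have h2 := hψ.smooth.differentiable (by simp) x
  ext i
  simp [grad, fderiv_add h1 h2]

theorem grad_smul {Ω : Set Plane} {φ : Plane → ℂ} (c : ℂ) (hφ : IsTestFunction Ω φ)
    (x : Plane) : grad (c • φ) x = c • grad φ x := by
  have h1 := hφ.smooth.differentiable (by simp) x
  ext i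
  simp [grad, fderiv_const_smul h1 c]

/-- The pairs `(φ, ∇φ)`, `φ ∈ C_c^∞(Ω)`, in `L²(Ω) × L²(Ω)²`. -/
def testPairs (Ω : Set Plane) : Submodule ℂ (L2 Ω × L2Vec Ω) where
  carrier := {p | ∃ φ : Plane → ℂ, IsTestFunction Ω φ ∧
    p.1 =ᵐ[volume.restrict Ω] φ ∧ p.2 =ᵐ[volume.restrict Ω] grad φ}
  zero_mem' := by
    refine ⟨0, IsTestFunction.zero Ω, Lp.coeFn_zero _ _ _, ?_⟩
    have h : grad 0 = 0 := by
      funext x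
      ext i
      simp [grad]
    rw [h]
    exact Lp.coeFn_zero _ _ _
  add_mem' := by
    rintro p q ⟨φ, hφ, h1, h2⟩ ⟨ψ, hψ, h3, h4⟩
    refine ⟨φ + ψ, hφ.add hψ, (Lp.coeFn_add _ _).trans (h1.add h3), ?_⟩
    filter_upwards [Lp.coeFn_add p.2 q.2, h2, h4] with x hx h2 h4
    rw [grad_add hφ hψ, ← h2, ← h4]
    exact hx
  smul_mem' := by
    rintro c p ⟨φ, hφ, h1, h2⟩
    refine ⟨c • φ, hφ.smul c, (Lp.coeFn_smul _ _).trans (h1.const_smul c), ?_⟩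
    filter_upwards [Lp.coeFn_smul c p.2, h2] with x hx h2
    rw [grad_smul c hφ, ← h2]
    exact hx

/-- `H¹₀(Ω)`: the closure of `C_c^∞(Ω)` for the `H¹` norm, a function `v` being recorded together
with its weak gradient as the pair `(v, ∇v) ∈ L²(Ω) × L²(Ω)²`. This is a type of its own because
it carries the norm `‖∇v‖` and not the norm of the product. -/
def H10 (Ω : Set Plane) : Type := (testPairs Ω).topologicalClosure

instance (Ω : Set Plane) : AddCommGroup (H10 Ω) :=
  inferInstanceAs (AddCommGroup (testPairs Ω).topologicalClosure)

instance (Ω : Set Plane) : Module ℂ (H10 Ω) :=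
  inferInstanceAs (Module ℂ (testPairs Ω).topologicalClosure)

/-- The `L²` function underlying an element of `H¹₀(Ω)`. -/
def H10.toL2 {Ω : Set Plane} : H10 Ω →ₗ[ℂ] L2 Ω :=
  LinearMap.fst ℂ (L2 Ω) (L2Vec Ω) ∘ₗ (testPairs Ω).topologicalClosure.subtype

/-- The weak gradient of an element of `H¹₀(Ω)`. -/
def H10.gradient {Ω : Set Plane} : H10 Ω →ₗ[ℂ] L2Vec Ω :=
  LinearMap.snd ℂ (L2 Ω) (L2Vec Ω) ∘ₗ (testPairs Ω).topologicalClosure.subtype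

/-- `‖v‖_{H¹₀(Ω)} = ‖∇v‖_{L²(Ω)}`. (For bounded `Ω` this is definite, by Poincaré's inequality,
but that is not needed for the definitions below.) -/
instance (Ω : Set Plane) : SeminormedAddCommGroup (H10 Ω) :=
  SeminormedAddCommGroup.induced (H10 Ω) (L2Vec Ω) H10.gradient

instance (Ω : Set Plane) : NormedSpace ℂ (H10 Ω) :=
  NormedSpace.induced ℂ (H10 Ω) (L2Vec Ω) H10.gradient

theorem H10.norm_def {Ω : Set Plane} (u : H10 Ω) : ‖u‖ = ‖u.gradient‖ := rfl

/-- `H⁻¹(Ω)`: the continuous antilinear forms on `H¹₀(Ω)`, with the dual norm. -/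
abbrev Hneg1 (Ω : Set Plane) : Type := H10 Ω →L⋆[ℂ] ℂ

/-! ### The geometry and the coefficient -/

/-- `{(r cos θ, r sin θ) | δ < r < 1, α < θ < β}`. -/
def sector (δ α β : ℝ) : Set Plane :=
  (fun p : ℝ × ℝ => !₂[p.1 * Real.cos p.2, p.1 * Real.sin p.2]) '' (Ioo δ 1 ×ˢ Ioo α β)

/-- `Ω^δ` -/
def Omega (δ : ℝ) : Set Plane := sector δ 0 Real.pi

/-- `Ω₊^δ` -/
def OmegaPlus (δ : ℝ) : Set Plane := sector δ (Real.pi / 4) Real.pi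

/-- `Ω₋^δ` -/
def OmegaMinus (δ : ℝ) : Set Plane := sector δ 0 (Real.pi / 4)

open Classical in
/-- `σ^δ = σ₊` in `Ω₊^δ` and `σ^δ = σ₋` in `Ω₋^δ`. (The value `0` elsewhere is immaterial, the
interface being a null set.) -/
def sigma (σp σm δ : ℝ) (x : Plane) : ℝ :=
  if x ∈ OmegaPlus δ then σp else if x ∈ OmegaMinus δ then σm else 0

theorem measurableSet_sector (δ α β : ℝ) : MeasurableSet (sector δ α β) := by
  have ho : IsOpen (Ioo δ 1 ×ˢ Ioo α β) := isOpen_Ioo.prod isOpen_Ioo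
  have hs : IsSigmaCompact (Ioo δ 1 ×ˢ Ioo α β) := by
    have : LocallyCompactSpace (Ioo δ 1 ×ˢ Ioo α β : Set (ℝ × ℝ)) := ho.locallyCompactSpace
    exact isSigmaCompact_iff_sigmaCompactSpace.mpr inferInstance
  have hc : Continuous (fun p : ℝ × ℝ =>
      (!₂[p.1 * Real.cos p.2, p.1 * Real.sin p.2] : Plane)) := by
    refine (PiLp.continuous_toLp 2 _).comp (continuous_pi fun i => ?_)
    fin_cases i <;> simp <;> fun_prop
  obtain ⟨K, hK, hU⟩ := hs.image hc
  rw [sector, ← hU]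
  exact MeasurableSet.iUnion fun n => (hK n).measurableSet

theorem measurable_sigma (σp σm δ : ℝ) : Measurable (sigma σp σm δ) :=
  Measurable.ite (measurableSet_sector _ _ _) measurable_const
    (Measurable.ite (measurableSet_sector _ _ _) measurable_const measurable_const)

theorem abs_sigma_le (σp σm δ : ℝ) (x : Plane) : |sigma σp σm δ x| ≤ |σp| + |σm| := by
  unfold sigma
  split_ifs <;> simp [add_nonneg]

/-! ### The operator -/

/-- `(σ^δ ∇u, ∇v)_{Ω^δ} = ∫_{Ω^δ} σ^δ ∇u · conj ∇v`. (The inner product of `ℂ²` is antilinear in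
its first argument.) -/
def form (σp σm δ : ℝ) (u v : H10 (Omega δ)) : ℂ :=
  ∫ x in Omega δ, (sigma σp σm δ x : ℂ) * inner ℂ (v.gradient x) (u.gradient x)

theorem integrable_form (σp σm δ : ℝ) (u v : H10 (Omega δ)) :
    Integrable (fun x => (sigma σp σm δ x : ℂ) * inner ℂ (v.gradient x) (u.gradient x))
      (volume.restrict (Omega δ)) := by
  refine (L2.integrable_inner (𝕜 := ℂ) v.gradient u.gradient).bdd_mul (c := |σp| + |σm|)
    ((Complex.measurable_ofReal.comp (measurable_sigma σp σm δ)).aestronglyMeasurable) ?_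
  filter_upwards with x
  simpa using abs_sigma_le σp σm δ x

theorem norm_form_le (σp σm δ : ℝ) (u v : H10 (Omega δ)) :
    ‖form σp σm δ u v‖ ≤ (|σp| + |σm|) * ‖u‖ * ‖v‖ := by
  have hb : ∀ x, ‖(sigma σp σm δ x : ℂ) • u.gradient x‖ ≤ (|σp| + |σm|) * ‖u.gradient x‖ := by
    intro x
    rw [norm_smul, Complex.norm_real, Real.norm_eq_abs]
    exact mul_le_mul_of_nonneg_right (abs_sigma_le σp σm δ x) (norm_nonneg _)
  have hm : MemLp (fun x => (sigma σp σm δ x : ℂ) • u.gradient x) 2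
      (volume.restrict (Omega δ)) :=
    (Lp.memLp u.gradient).of_le_mul
      ((Complex.measurable_ofReal.comp (measurable_sigma σp σm δ)).aestronglyMeasurable.smul
        (Lp.aestronglyMeasurable u.gradient)) (Filter.Eventually.of_forall hb)
  have he : form σp σm δ u v = inner ℂ v.gradient (hm.toLp _) := by
    rw [form, L2.inner_def]
    refine integral_congr_ae ?_
    filter_upwards [hm.coeFn_toLp] with x hx
    rw [hx, inner_smul_right]
  have hn : ‖hm.toLp _‖ ≤ (|σp| + |σm|) * ‖u.gradient‖ := by
    refine Lp.norm_le_mul_norm_of_ae_le_mul ?_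
    filter_upwards [hm.coeFn_toLp] with x hx
    rw [hx]
    exact hb x
  rw [he, H10.norm_def, H10.norm_def, mul_comm _ ‖v.gradient‖]
  exact (norm_inner_le_norm _ _).trans (mul_le_mul_of_nonneg_left hn (norm_nonneg _))

/-- The operator `A^δ : H¹₀(Ω^δ) → H⁻¹(Ω^δ)`, `⟨A^δ u, v⟩ = (σ^δ ∇u, ∇v)_{Ω^δ}`. -/
def A (σp σm δ : ℝ) : H10 (Omega δ) →L[ℂ] Hneg1 (Omega δ) :=
  LinearMap.mkContinuous₂
    (LinearMap.mk₂'ₛₗ (RingHom.id ℂ) (starRingEnd ℂ) (form σp σm δ)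
      (by
        intro u u' v
        rw [form, form, form, ← integral_add (integrable_form ..) (integrable_form ..)]
        refine integral_congr_ae ?_
        rw [map_add]
        filter_upwards [Lp.coeFn_add u.gradient u'.gradient] with x hx
        rw [hx, Pi.add_apply, inner_add_right, mul_add])
      (by
        intro c u v
        rw [form, form, RingHom.id_apply, smul_eq_mul, ← integral_const_mul]
        refine integral_congr_ae ?_
        rw [map_smul]
        filter_upwards [Lp.coeFn_smul c u.gradient] with x hx
        rw [hx, Pi.smul_apply, inner_smul_right]
        ring)
      (by
        intro u v v'
        rw [form, form, form, ← integral_add (integrable_form ..) (integrable_form ..)]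
        refine integral_congr_ae ?_
        rw [map_add]
        filter_upwards [Lp.coeFn_add v.gradient v'.gradient] with x hx
        rw [hx, Pi.add_apply, inner_add_left, mul_add])
      (by
        intro c u v
        rw [form, form, smul_eq_mul, ← integral_const_mul]
        refine integral_congr_ae ?_
        rw [map_smul]
        filter_upwards [Lp.coeFn_smul c v.gradient] with x hx
        rw [hx, Pi.smul_apply, inner_smul_left]
        ring))
    (|σp| + |σm|) (norm_form_le σp σm δ)

theorem A_apply (σp σm δ : ℝ) (u v : H10 (Omega δ)) :
    A σp σm δ u v =
      ∫ x in Omega δ, (sigma σp σm δ x : ℂ) * inner ℂ (v.gradient x) (u.gradient x) := rfl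

end HalfAnnulus

end

/-!
T-coercivity. Suppose `σ` has modulus `b` on one sector `U` and `a` on the other, with opposite
signs. Let `R` be the map that preserves the radius and multiplies the angle to the interface by
`-(2 * m + 1)`; it maps `U` out of `U`, with `m = 0` for the large sector and `m = 1` for the small
one. Put `T u = u` off `U` and `T u = -u + 2 u ∘ R` on `U`, where `R` fixes the interface, so that
`T u ∈ H¹₀`. Then `|Re ⟨A u, T u⟩|` is at least

  `a ‖∇u‖² (off U) + b ‖∇u‖² (on U) - 2 b |∫_U ∇u · ∇(u ∘ R)|`.

As `R` has dilatation at most `N = 2 * m + 1`, the energy of `u ∘ R` on `U` is at most `N` times the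
energy of `u` off `U`, and Cauchy–Schwarz absorbs the last term as soon as `N * b < a`, with a
constant depending only on `N`, `a`, `b`. With `N = 1` this is `κ < -1`, with `N = 3` it is
`κ > -1/3`. The bound makes the Hermitian form invertible on the Hilbert space `H¹₀`.
-/

open MeasureTheory Set
open scoped ContDiff

noncomputable section

namespace HalfAnnulus

section Hermitian

open InnerProductSpace

theorem surjective_of_hermitian_of_bounded_below {V : Type*} [NormedAddCommGroup V]
    [InnerProductSpace ℂ V] [CompleteSpace V] (a : V →L[ℂ] V →L⋆[ℂ] ℂ)
    (hsymm : ∀ u v, a u v = starRingEnd ℂ (a v u)) {c : ℝ} (hbound : ∀ u, ‖u‖ ≤ c * ‖a u‖) :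
    Function.Surjective a := by
  set M : V →L[ℂ] V := continuousLinearMapOfBilin a.flip
  have inner_M : ∀ u v, inner ℂ (M u) v = a v u := fun u v => by
    simp only [M, continuousLinearMapOfBilin_apply, ContinuousLinearMap.flip_apply]
  have norm_a_le : ∀ u, ‖a u‖ ≤ ‖M u‖ := fun u =>
    ContinuousLinearMap.opNorm_le_bound _ (norm_nonneg _) fun v => by
      rw [hsymm, RCLike.norm_conj, ← inner_M]
      exact norm_inner_le_norm _ _
  have M_symm : (M : V →ₗ[ℂ] V).IsSymmetric := fun u v => by
    rw [← inner_conj_symm u]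
    simp only [ContinuousLinearMap.coe_coe, inner_M]
    exact hsymm v u
  have M_anti : AntilipschitzWith c.toNNReal M := M.antilipschitz_of_bound fun u =>
    (hbound u).trans (mul_le_mul (Real.le_coe_toNNReal c) (norm_a_le u) (norm_nonneg _)
      c.toNNReal.2)
  have M_bij : Function.Bijective M := by
    refine M.bijective_iff_dense_range_and_antilipschitz.2 ⟨?_, _, M_anti⟩
    rw [Submodule.topologicalClosure_eq_top_iff]
    exact M_symm.orthogonal_range.trans (LinearMap.ker_eq_bot.2 M_anti.injective)
  intro F
  obtain ⟨u, hu⟩ := M_bij.2 ((toDual ℂ V).symm ((starL ℂ).toContinuousLinearMap.comp F))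
  refine ⟨u, ContinuousLinearMap.ext fun v => ?_⟩
  rw [hsymm, ← inner_M, hu, toDual_symm_apply]
  exact star_star (F v)

theorem exists_continuousLinearEquiv_of_hermitian {X V : Type*} [SeminormedAddCommGroup X]
    [NormedSpace ℂ X] [NormedAddCommGroup V] [InnerProductSpace ℂ V] [CompleteSpace V]
    (ι : X ≃ₗᵢ[ℂ] V) (a : X →L[ℂ] X →L⋆[ℂ] ℂ)
    (hsymm : ∀ u v, a u v = starRingEnd ℂ (a v u)) {c : ℝ} (hbound : ∀ u, ‖u‖ ≤ c * ‖a u‖) :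
    ∃ e : X ≃L[ℂ] (X →L⋆[ℂ] ℂ), ∀ u, e u = a u := by
  let κ : V →L[ℂ] X := ι.symm.toContinuousLinearEquiv
  have norm_le_comp : ∀ F : X →L⋆[ℂ] ℂ, ‖F‖ ≤ ‖F.comp κ‖ := fun F =>
    F.opNorm_le_bound (norm_nonneg _) fun v => by simpa [κ] using (F.comp κ).le_opNorm (ι v)
  let b : V →L[ℂ] V →L⋆[ℂ] ℂ := a.bilinearComp κ κ
  have b_apply : ∀ u, b u = (a (κ u)).comp κ := fun u => rfl
  have b_surj : Function.Surjective b :=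
    surjective_of_hermitian_of_bounded_below b (c := c.toNNReal) (fun u v => hsymm _ _) fun u =>
      calc ‖u‖ = ‖κ u‖ := (ι.symm.norm_map u).symm
        _ ≤ c * ‖a (κ u)‖ := hbound _
        _ ≤ c.toNNReal * ‖b u‖ := mul_le_mul (Real.le_coe_toNNReal c) (norm_le_comp _)
          (norm_nonneg _) c.toNNReal.2
  have a_surj : Function.Surjective a := fun F => by
    obtain ⟨u, hu⟩ := b_surj (F.comp κ)
    refine ⟨κ u, ContinuousLinearMap.ext fun v => ?_⟩
    simpa [b_apply, κ] using DFunLike.congr_fun hu (ι v)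
  have a_inj : Function.Injective a := (injective_iff_map_eq_zero a).2 fun u hu => by
    have h := hbound u
    rw [hu, norm_zero, mul_zero, ← ι.norm_map] at h
    exact ι.map_eq_zero_iff.1 (norm_le_zero_iff.1 h)
  let e := LinearEquiv.ofBijective (a : X →ₗ[ℂ] X →L⋆[ℂ] ℂ) ⟨a_inj, a_surj⟩
  have e_symm : ∀ F, a (e.symm F) = F := e.apply_symm_apply
  refine ⟨e.toContinuousLinearEquivOfBounds ‖a‖ c a.le_opNorm fun F => ?_, fun u => rfl⟩
  simpa only [e_symm] using hbound (e.symm F)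

end Hermitian

/-! ### Gradients and test functions -/

/-- The gradient of a function with differential `L`, see `grad_eq_gradOf`. -/
def gradOf : (Plane →L[ℝ] ℂ) →L[ℝ] EuclideanSpace ℂ (Fin 2) :=
  LinearMap.toContinuousLinearMap
    { toFun := fun L => WithLp.toLp 2 fun i => L (EuclideanSpace.single i 1)
      map_add' := fun _ _ => rfl
      map_smul' := fun _ _ => rfl }

theorem grad_eq_gradOf (φ : Plane → ℂ) (x : Plane) : grad φ x = gradOf (fderiv ℝ φ x) := rfl

theorem sum_sq_apply_single (ℓ : Plane →L[ℝ] ℝ) :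
    ∑ i, ℓ (EuclideanSpace.single i 1) ^ 2 = ‖ℓ‖ ^ 2 := by
  obtain ⟨y, rfl⟩ := (InnerProductSpace.toDual ℝ Plane).surjective ℓ
  simp [EuclideanSpace.inner_single_right, EuclideanSpace.real_norm_sq_eq]

theorem norm_gradOf_sq (L : Plane →L[ℝ] ℂ) :
    ‖gradOf L‖ ^ 2 = ‖Complex.reCLM.comp L‖ ^ 2 + ‖Complex.imCLM.comp L‖ ^ 2 := by
  rw [← sum_sq_apply_single, ← sum_sq_apply_single, ← Finset.sum_add_distrib,
    EuclideanSpace.norm_sq_eq]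
  refine Finset.sum_congr rfl fun i _ => ?_
  refine (Complex.normSq_eq_norm_sq _).symm.trans ?_
  rw [Complex.normSq_apply, ← sq, ← sq]
  rfl

theorem norm_le_norm_gradOf (L : Plane →L[ℝ] ℂ) : ‖L‖ ≤ ‖gradOf L‖ := by
  refine L.opNorm_le_bound (norm_nonneg _) fun v => ?_
  rw [← sq_le_sq₀ (norm_nonneg _) (by positivity), mul_pow, norm_gradOf_sq, add_mul, ← mul_pow,
    ← mul_pow, ← Complex.normSq_eq_norm_sq, Complex.normSq_apply, ← sq, ← sq]
  exact add_le_add (sq_le_sq.2 (((Complex.reCLM.comp L).le_opNorm v).trans (le_abs_self _)))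
    (sq_le_sq.2 (((Complex.imCLM.comp L).le_opNorm v).trans (le_abs_self _)))

theorem norm_gradOf_comp_le (L : Plane →L[ℝ] ℂ) (T : Plane →L[ℝ] Plane) :
    ‖gradOf (L.comp T)‖ ≤ ‖T‖ * ‖gradOf L‖ := by
  have comp_le (ℓ : Plane →L[ℝ] ℝ) : ‖ℓ.comp T‖ ^ 2 ≤ ‖T‖ ^ 2 * ‖ℓ‖ ^ 2 := by
    rw [← mul_pow, mul_comm]
    exact pow_le_pow_left₀ (norm_nonneg _) (ℓ.opNorm_comp_le T) 2
  rw [← sq_le_sq₀ (norm_nonneg _) (by positivity), mul_pow, norm_gradOf_sq, norm_gradOf_sq,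
    mul_add, ← ContinuousLinearMap.comp_assoc, ← ContinuousLinearMap.comp_assoc]
  exact add_le_add (comp_le _) (comp_le _)

theorem hasCompactSupport_grad {f : Plane → ℂ} (hf : HasCompactSupport f) :
    HasCompactSupport (grad f) :=
  (hf.fderiv ℝ).comp_left (g := gradOf) (map_zero _)

namespace IsTestFunction

variable {Ω : Set Plane} {φ : Plane → ℂ}

theorem continuous_grad (hφ : IsTestFunction Ω φ) : Continuous (grad φ) :=
  gradOf.continuous.comp (hφ.smooth.continuous_fderiv (by simp))

theorem memLp (hφ : IsTestFunction Ω φ) : MemLp φ 2 (volume.restrict Ω) :=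
  (hφ.smooth.continuous.memLp_of_hasCompactSupport hφ.compact).restrict Ω

theorem memLp_grad (hφ : IsTestFunction Ω φ) : MemLp (grad φ) 2 :=
  hφ.continuous_grad.memLp_of_hasCompactSupport (hasCompactSupport_grad hφ.compact)

/-- A test function as an element of `H¹₀(Ω)`. -/
def toH10 (hφ : IsTestFunction Ω φ) : H10 Ω :=
  ⟨(hφ.memLp.toLp φ, (hφ.memLp_grad.restrict Ω).toLp (grad φ)), Submodule.le_topologicalClosure _
    ⟨φ, hφ, hφ.memLp.coeFn_toLp, (hφ.memLp_grad.restrict Ω).coeFn_toLp⟩⟩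

theorem gradient_toH10 (hφ : IsTestFunction Ω φ) :
    hφ.toH10.gradient =ᵐ[volume.restrict Ω] grad φ := (hφ.memLp_grad.restrict Ω).coeFn_toLp

theorem eq_zero_of_notMem (hφ : IsTestFunction Ω φ) {x : Plane} (hx : x ∉ Ω) : φ x = 0 :=
  image_eq_zero_of_notMem_tsupport fun h => hx (hφ.support h)

theorem support_fderiv_subset (hφ : IsTestFunction Ω φ) : (fderiv ℝ φ).support ⊆ Ω :=
  (_root_.support_fderiv_subset ℝ).trans hφ.support

end IsTestFunction

theorem dense_test (Ω : Set Plane) :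
    Dense {u : H10 Ω | ∃ φ, ∃ hφ : IsTestFunction Ω φ, u = hφ.toH10} := by
  intro u
  rw [Metric.mem_closure_iff]
  intro ε hε
  obtain ⟨q, ⟨φ, hφ, -, hgrad⟩, hdist⟩ := Metric.mem_closure_iff.1 u.2 ε hε
  refine ⟨hφ.toH10, ⟨φ, hφ, rfl⟩, ?_⟩
  have h : q.2 = hφ.toH10.gradient := Lp.ext (hgrad.trans hφ.gradient_toH10.symm)
  rw [dist_eq_norm, H10.norm_def, map_sub, ← h, ← dist_eq_norm]
  exact lt_of_le_of_lt (le_max_right _ _) hdist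

/-! ### Poincaré's inequality and completeness -/

section Poincare

open scoped NNReal

variable {Ω : Set Plane}

/-- The constant in Poincaré's inequality, coming from the embedding of `W^{1,1}` into `L²` in
dimension two and from Hölder's inequality. -/
def poincareConst (Ω : Set Plane) : ℝ≥0 :=
  eLpNormLESNormFDerivOneConst (volume : Measure Plane) 2 * (volume Ω ^ (2⁻¹ : ℝ)).toNNReal

theorem IsTestFunction.eLpNorm_le_eLpNorm_fderiv {φ : Plane → ℂ} (hφ : IsTestFunction Ω φ) :
    eLpNorm φ 2 (volume.restrict Ω) ≤ eLpNormLESNormFDerivOneConst (volume : Measure Plane) 2 *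
      eLpNorm (fderiv ℝ φ) 1 (volume.restrict Ω) := by
  have hp : NNReal.HolderConjugate (Module.finrank ℝ Plane) 2 := by
    rw [finrank_euclideanSpace_fin]
    exact NNReal.HolderConjugate.two_two
  rw [eLpNorm_restrict_eq_of_support_subset hφ.support_fderiv_subset (f := fderiv ℝ φ)]
  exact (eLpNorm_mono_measure φ Measure.restrict_le_self).trans
    (eLpNorm_le_eLpNorm_fderiv_one volume (hφ.smooth.of_le (by simp)) hφ.compact hp)

theorem IsTestFunction.eLpNorm_fderiv_le {φ : Plane → ℂ} (hφ : IsTestFunction Ω φ) :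
    eLpNorm (fderiv ℝ φ) 1 (volume.restrict Ω) ≤
      eLpNorm (grad φ) 2 (volume.restrict Ω) * volume Ω ^ (2⁻¹ : ℝ) := by
  have hölder := eLpNorm_le_eLpNorm_mul_rpow_measure_univ (μ := volume.restrict Ω) one_le_two
    (hφ.smooth.continuous_fderiv (by simp)).aestronglyMeasurable
  rw [Measure.restrict_apply_univ, ENNReal.toReal_one, ENNReal.toReal_ofNat,
    show (1 / 1 - 1 / 2 : ℝ) = 2⁻¹ by norm_num] at hölder
  exact hölder.trans (mul_le_mul_left (eLpNorm_mono fun x => norm_le_norm_gradOf _) _)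

theorem norm_toL2_le (hΩ : volume Ω ≠ ⊤) (u : H10 Ω) :
    ‖u.toL2‖ ≤ poincareConst Ω * ‖u‖ := by
  have hcl : IsClosed {p : L2 Ω × L2Vec Ω | ‖p.1‖ ≤ poincareConst Ω * ‖p.2‖} :=
    isClosed_le (by fun_prop) (by fun_prop)
  refine closure_minimal ?_ hcl u.2
  rintro p ⟨φ, hφ, hp, hgrad⟩
  have h := hφ.eLpNorm_le_eLpNorm_fderiv.trans (mul_le_mul_right hφ.eLpNorm_fderiv_le _)
  rw [← eLpNorm_congr_ae hp, ← eLpNorm_congr_ae hgrad] at h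
  have hfin : volume Ω ^ (2⁻¹ : ℝ) ≠ ⊤ := ENNReal.rpow_ne_top_of_nonneg (by positivity) hΩ
  have := ENNReal.toReal_mono (ENNReal.mul_ne_top ENNReal.coe_ne_top
    (ENNReal.mul_ne_top (Lp.eLpNorm_ne_top p.2) hfin)) h
  rw [ENNReal.toReal_mul, ENNReal.toReal_mul] at this
  refine this.trans_eq ?_
  simp only [poincareConst, Lp.norm_def, NNReal.coe_mul, ENNReal.coe_toReal,
    ENNReal.coe_toNNReal_eq_toReal]
  ring

theorem isClosed_range_gradient (hΩ : volume Ω ≠ ⊤) :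
    IsClosed (LinearMap.range (H10.gradient (Ω := Ω)) : Set (L2Vec Ω)) := by
  let T : (testPairs Ω).topologicalClosure →L[ℂ] L2Vec Ω :=
    (ContinuousLinearMap.snd ℂ (L2 Ω) (L2Vec Ω)).comp (testPairs Ω).topologicalClosure.subtypeL
  have T_anti : AntilipschitzWith (max (poincareConst Ω) 1) T :=
    T.antilipschitz_of_bound fun p => by
      rw [NNReal.coe_max, max_mul_of_nonneg _ _ (norm_nonneg _), NNReal.coe_one, one_mul]
      exact max_le_max (norm_toL2_le hΩ p) le_rfl
  exact T_anti.isClosed_range T.uniformContinuous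

/-- `H¹₀(Ω)` is isometric to the space of its gradients. -/
def H10.equivRange (hΩ : volume Ω ≠ ⊤) : H10 Ω ≃ₗᵢ[ℂ] LinearMap.range (H10.gradient (Ω := Ω)) where
  toLinearEquiv := LinearEquiv.ofInjective H10.gradient <|
    (injective_iff_map_eq_zero _).2 fun u hu => by
      have h := norm_toL2_le hΩ u
      rw [H10.norm_def, hu, norm_zero, mul_zero] at h
      exact Subtype.ext (Prod.ext (norm_le_zero_iff.1 h) hu)
  norm_map' _ := rfl

theorem completeSpace_range_gradient (hΩ : volume Ω ≠ ⊤) :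
    CompleteSpace (LinearMap.range (H10.gradient (Ω := Ω))) :=
  (isClosed_range_gradient hΩ).completeSpace_coe

end Poincare

/-! ### Lipschitz functions with compact support belong to `H¹₀` -/

section Lipschitz

open Filter Topology ContinuousLinearMap
open scoped Convolution NNReal ENNReal

theorem tendsto_toLp_of_dominated {α E : Type*} [MeasurableSpace α] {μ : Measure α}
    [NormedAddCommGroup E] {p : ℝ≥0∞} [Fact (1 ≤ p)] (hp : p ≠ ⊤) {F : ℕ → α → E} {G : α → E}
    {g : α → ℝ} (hF : ∀ n, MemLp (F n) p μ) (hG : MemLp G p μ) (hg : MemLp g p μ)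
    (hbound : ∀ n x, ‖F n x‖ ≤ g x) (hlim : ∀ᵐ x ∂μ, Tendsto (fun n => F n x) atTop (𝓝 (G x))) :
    Tendsto (fun n => (hF n).toLp (F n)) atTop (𝓝 (hG.toLp G)) := by
  have p_pos : 0 < p := zero_lt_one.trans_le Fact.out
  have p_toReal : 0 < p.toReal := ENNReal.toReal_pos p_pos.ne' hp
  have sub_le : ∀ n, ∀ᵐ x ∂μ, ‖F n x - G x‖ₑ ^ p.toReal ≤ (2 * ‖g x‖ₑ) ^ p.toReal := fun n => by
    filter_upwards [hlim] with x hx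
    have hGx : ‖G x‖ ≤ g x := le_of_tendsto hx.norm (Eventually.of_forall fun n => hbound n x)
    gcongr
    rw [two_mul]
    refine enorm_sub_le.trans (add_le_add ?_ ?_) <;> rw [enorm_le_iff_norm_le]
    exacts [(hbound n x).trans (le_abs_self _), hGx.trans (le_abs_self _)]
  have sub_tendsto : ∀ᵐ x ∂μ, Tendsto (fun n => ‖F n x - G x‖ₑ ^ p.toReal) atTop (𝓝 0) := by
    filter_upwards [hlim] with x hx
    have := (ENNReal.continuous_rpow_const (y := p.toReal)).tendsto _ |>.comp
      ((hx.sub_const (G x)).enorm)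
    simpa [Function.comp_def, ENNReal.zero_rpow_of_pos p_toReal] using this
  have g_fin : ∫⁻ x, (2 * ‖g x‖ₑ) ^ p.toReal ∂μ ≠ ⊤ := by
    simp_rw [ENNReal.mul_rpow_of_nonneg _ _ p_toReal.le]
    rw [lintegral_const_mul' _ _ (ENNReal.rpow_ne_top_of_nonneg p_toReal.le ENNReal.ofNat_ne_top)]
    exact ENNReal.mul_ne_top (ENNReal.rpow_ne_top_of_nonneg p_toReal.le ENNReal.ofNat_ne_top)
      (lintegral_rpow_enorm_lt_top_of_eLpNorm_lt_top p_pos.ne' hp hg.2).ne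
  have := tendsto_lintegral_of_dominated_convergence' _
    (fun n => ((hF n).sub hG).1.enorm.pow_const p.toReal) sub_le g_fin sub_tendsto
  rw [lintegral_zero] at this
  rw [Lp.tendsto_Lp_iff_tendsto_eLpNorm'']
  simp_rw [eLpNorm_eq_lintegral_rpow_enorm_toReal p_pos.ne' hp]
  simpa [Function.comp_def, p_toReal] using
    ((ENNReal.continuous_rpow_const (y := 1 / p.toReal)).tendsto 0).comp this

theorem exists_seq_contDiffBump (E : Type*) [NormedAddCommGroup E] {η : ℝ} (hη : 0 < η) :
    ∃ ρ : ℕ → ContDiffBump (0 : E), (∀ n, (ρ n).rOut ≤ η) ∧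
      Tendsto (fun n => (ρ n).rOut) atTop (𝓝 0) ∧ ∀ n, (ρ n).rOut ≤ 2 * (ρ n).rIn := by
  refine ⟨fun n => ⟨η / 2 / (n + 1), η / (n + 1), by positivity, by gcongr; linarith⟩,
    fun n => div_le_self hη.le (by linarith [(Nat.cast_nonneg n : (0 : ℝ) ≤ n)]), ?_,
    fun n => (by ring : η / (n + 1) = 2 * (η / 2 / (n + 1))).le⟩
  simpa [div_eq_mul_inv] using (tendsto_one_div_add_atTop_nhds_zero_nat (𝕜 := ℝ)).const_mul η

theorem norm_le_indicator {α E : Type*} [NormedAddCommGroup E] {S : Set α} {f : α → E} {B : ℝ}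
    (hf : f.support ⊆ S) (hB : ∀ x, ‖f x‖ ≤ B) (x : α) : ‖f x‖ ≤ S.indicator (fun _ => B) x := by
  by_cases hx : x ∈ S
  · rw [indicator_of_mem hx]
    exact hB x
  · rw [indicator_of_notMem hx, Function.notMem_support.1 fun h => hx (hf h), norm_zero]

section Mollification

variable {E F : Type*} [NormedAddCommGroup E] [NormedSpace ℝ E] [FiniteDimensional ℝ E]
  [MeasurableSpace E] [BorelSpace E] {μ : Measure E} [μ.IsAddHaarMeasure]
  [NormedAddCommGroup F] [NormedSpace ℝ F]

theorem hasFDerivAt_convolution_of_lipschitz {ρ : E → ℝ} (hρ : Continuous ρ)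
    (hρs : HasCompactSupport ρ) [FiniteDimensional ℝ F] {f : E → F} {K : ℝ≥0}
    (hf : LipschitzWith K f) (x : E) :
    HasFDerivAt (ρ ⋆[lsmul ℝ ℝ, μ] f) ((ρ ⋆[lsmul ℝ ℝ, μ] fderiv ℝ f) x) x := by
  have integrable_smul : ∀ y, Integrable (fun t => ρ t • f (y - t)) μ := fun y =>
    (hρ.smul (hf.continuous.comp (by fun_prop))).integrable_of_hasCompactSupport
      hρs.smul_right
  have diff_ae : ∀ᵐ t ∂μ, DifferentiableAt ℝ f (x - t) :=
    (Measure.measurePreserving_sub_left μ x).quasiMeasurePreserving.ae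
      hf.ae_differentiableAt
  refine (hasFDerivAt_integral_of_dominated_loc_of_lip' (𝕜 := ℝ) (s := univ)
    (F := fun y t => ρ t • f (y - t)) (F' := fun t => ρ t • fderiv ℝ f (x - t))
    (bound := fun t => K * ‖ρ t‖) univ_mem
    (fun y _ => (integrable_smul y).aestronglyMeasurable)
    (integrable_smul x) ?_ ?_ ((hρ.integrable_of_hasCompactSupport hρs).norm.const_mul _) ?_).2
  · exact hρ.aestronglyMeasurable.smul ((measurable_fderiv ℝ f).stronglyMeasurable.comp_measurable
      (measurable_const.sub measurable_id)).aestronglyMeasurable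
  · refine Eventually.of_forall fun t y _ => ?_
    have := hf.dist_le_mul (y - t) (x - t)
    rw [dist_sub_right, dist_eq_norm, dist_eq_norm] at this
    calc ‖ρ t • f (y - t) - ρ t • f (x - t)‖ = ‖ρ t‖ * ‖f (y - t) - f (x - t)‖ := by
          rw [← smul_sub, norm_smul]
      _ ≤ ‖ρ t‖ * (K * ‖y - x‖) := by gcongr
      _ = K * ‖ρ t‖ * ‖y - x‖ := by ring
  · filter_upwards [diff_ae] with t ht
    exact ((hasFDerivAt_comp_sub t).2 ht.hasFDerivAt).const_smul (ρ t)

variable (ρ : ContDiffBump (0 : E))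

theorem norm_normed_convolution_le {g : E → F} {B : ℝ} (hB : ∀ x, ‖g x‖ ≤ B) (x : E) :
    ‖(ρ.normed μ ⋆[lsmul ℝ ℝ, μ] g) x‖ ≤ B := by
  refine (norm_integral_le_of_norm_le ((ρ.integrable_normed (μ := μ)).mul_const B)
    (Eventually.of_forall fun t => ?_)).trans_eq ?_
  · rw [lsmul_apply, norm_smul, Real.norm_of_nonneg (ρ.nonneg_normed t)]
    exact mul_le_mul_of_nonneg_left (hB _) (ρ.nonneg_normed t)
  · rw [integral_mul_const, ρ.integral_normed, one_mul]

theorem tsupport_normed_convolution_subset (f : E → F) :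
    tsupport (ρ.normed μ ⋆[lsmul ℝ ℝ, μ] f) ⊆
      Metric.cthickening ρ.rOut (tsupport f) := by
  refine closure_minimal (fun x hx => ?_) Metric.isClosed_cthickening
  obtain ⟨a, ha, b, hb, rfl⟩ := support_convolution_subset (lsmul ℝ ℝ) hx
  rw [ρ.support_normed_eq] at ha
  refine Metric.mem_cthickening_of_dist_le _ b _ _ (subset_tsupport f hb) ?_
  simpa only [dist_eq_norm, add_sub_cancel_right] using (mem_ball_zero_iff.1 ha).le

theorem tendsto_toLp_normed_convolution [CompleteSpace F] {p : ℝ≥0∞} [Fact (1 ≤ p)] (hp : p ≠ ⊤)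
    {ρ : ℕ → ContDiffBump (0 : E)} {η C B : ℝ} (ρ_le : ∀ n, (ρ n).rOut ≤ η)
    (ρ_lim : Tendsto (fun n => (ρ n).rOut) atTop (𝓝 0)) (ρ_ratio : ∀ n, (ρ n).rOut ≤ C * (ρ n).rIn)
    {g : E → F} (hg : LocallyIntegrable g μ) (hgs : HasCompactSupport g) (hB : ∀ x, ‖g x‖ ≤ B)
    {Ω : Set E} (hmem : ∀ n, MemLp ((ρ n).normed μ ⋆[lsmul ℝ ℝ, μ] g) p (μ.restrict Ω))
    (hmem' : MemLp g p (μ.restrict Ω)) :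
    Tendsto (fun n => (hmem n).toLp _) atTop (𝓝 (hmem'.toLp g)) := by
  have hS : IsCompact (Metric.cthickening η (tsupport g)) := hgs.isCompact.cthickening
  refine tendsto_toLp_of_dominated hp hmem hmem'
    ((memLp_indicator_const p hS.measurableSet B (Or.inr hS.measure_ne_top)).restrict Ω)
    (fun n => norm_le_indicator ?_ (norm_normed_convolution_le (ρ n) hB))
    (ae_restrict_of_ae (ContDiffBump.ae_convolution_tendsto_right_of_locallyIntegrable ρ_lim
      (Eventually.of_forall ρ_ratio) hg))
  exact (subset_tsupport _).trans
    ((tsupport_normed_convolution_subset (ρ n) g).trans (Metric.cthickening_mono (ρ_le n) _))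

end Mollification

theorem isTestFunction_normed_convolution {Ω : Set Plane} {f : Plane → ℂ}
    (ρ : ContDiffBump (0 : Plane)) (hf : Continuous f) (hfs : HasCompactSupport f)
    (hΩ : Metric.cthickening ρ.rOut (tsupport f) ⊆ Ω) :
    IsTestFunction Ω (ρ.normed volume ⋆[lsmul ℝ ℝ, volume] f) where
  smooth := ρ.hasCompactSupport_normed.contDiff_convolution_left (lsmul ℝ ℝ)
    ρ.contDiff_normed hf.locallyIntegrable
  compact := ρ.hasCompactSupport_normed.convolution (lsmul ℝ ℝ) hfs
  support := (tsupport_normed_convolution_subset ρ f).trans hΩ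

theorem norm_grad_le_of_lipschitz {f : Plane → ℂ} {K : ℝ≥0} (hf : LipschitzWith K f) (x : Plane) :
    ‖grad f x‖ ≤ ‖gradOf‖ * K :=
  gradOf.le_opNorm_of_le (norm_fderiv_le_of_lipschitz ℝ hf)

theorem measurable_grad (f : Plane → ℂ) : Measurable (grad f) :=
  gradOf.continuous.measurable.comp (measurable_fderiv ℝ f)

theorem locallyIntegrable_grad_of_lipschitz {f : Plane → ℂ} {K : ℝ≥0} (hf : LipschitzWith K f) :
    LocallyIntegrable (grad f) :=
  (locallyIntegrable_const (‖gradOf‖ * K)).mono (measurable_grad f).aestronglyMeasurable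
    (Eventually.of_forall fun x => (norm_grad_le_of_lipschitz hf x).trans (le_abs_self _))

theorem memLp_grad_of_lipschitz {f : Plane → ℂ} {K : ℝ≥0} (hf : LipschitzWith K f)
    (hfs : HasCompactSupport f) {p : ℝ≥0∞} : MemLp (grad f) p :=
  (memLp_indicator_const p (isClosed_tsupport (grad f)).measurableSet (‖gradOf‖ * K)
    (Or.inr (hasCompactSupport_grad hfs).isCompact.measure_ne_top)).mono'
    (measurable_grad f).aestronglyMeasurable
    (Eventually.of_forall (norm_le_indicator (subset_tsupport _) (norm_grad_le_of_lipschitz hf)))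

theorem grad_normed_convolution (ρ : ContDiffBump (0 : Plane)) {f : Plane → ℂ} {K : ℝ≥0}
    (hf : LipschitzWith K f) :
    grad (ρ.normed volume ⋆[lsmul ℝ ℝ, volume] f) =
      ρ.normed volume ⋆[lsmul ℝ ℝ, volume] grad f := by
  have hloc : LocallyIntegrable (fderiv ℝ f) :=
    (locallyIntegrable_const (K : ℝ)).mono (measurable_fderiv ℝ f).aestronglyMeasurable
      (Eventually.of_forall fun x => (norm_fderiv_le_of_lipschitz ℝ hf).trans (le_abs_self _))
  funext x
  rw [grad_eq_gradOf, (hasFDerivAt_convolution_of_lipschitz ρ.continuous_normed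
    ρ.hasCompactSupport_normed hf x).fderiv, convolution_def, convolution_def,
    ← gradOf.integral_comp_comm
      (ρ.hasCompactSupport_normed.convolutionExists_left _ ρ.continuous_normed hloc x)]
  simp only [lsmul_apply, map_smul, grad_eq_gradOf]

theorem exists_H10_of_lipschitz {Ω : Set Plane} (hΩ : IsOpen Ω) {f : Plane → ℂ} {K : ℝ≥0}
    (hf : LipschitzWith K f) (hfs : HasCompactSupport f) (hsub : tsupport f ⊆ Ω) :
    ∃ v : H10 Ω, v.gradient =ᵐ[volume.restrict Ω] grad f := by
  obtain ⟨η, hη, hηΩ⟩ := hfs.isCompact.exists_cthickening_subset_open hΩ hsub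
  obtain ⟨ρ, ρ_le, ρ_lim, ρ_ratio⟩ := exists_seq_contDiffBump Plane hη
  obtain ⟨B, hB⟩ := hf.continuous.bounded_above_of_compact_support hfs
  have f_mem : MemLp f 2 (volume.restrict Ω) :=
    (hf.continuous.memLp_of_hasCompactSupport hfs).restrict Ω
  have grad_mem : MemLp (grad f) 2 (volume.restrict Ω) :=
    (memLp_grad_of_lipschitz hf hfs).restrict Ω
  have F_test (n : ℕ) : IsTestFunction Ω ((ρ n).normed volume ⋆[lsmul ℝ ℝ, volume] f) :=
    isTestFunction_normed_convolution (ρ n) hf.continuous hfs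
      ((Metric.cthickening_mono (ρ_le n) _).trans hηΩ)
  have grad_F (n : ℕ) := grad_normed_convolution (ρ n) hf
  have grad_F_mem (n : ℕ) :
      MemLp ((ρ n).normed volume ⋆[lsmul ℝ ℝ, volume] grad f) 2 (volume.restrict Ω) :=
    grad_F n ▸ (F_test n).memLp_grad.restrict Ω
  refine ⟨⟨(f_mem.toLp f, grad_mem.toLp (grad f)), ?_⟩, grad_mem.coeFn_toLp⟩
  refine mem_closure_of_tendsto (b := atTop)
    ((tendsto_toLp_normed_convolution ENNReal.ofNat_ne_top ρ_le ρ_lim ρ_ratio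
      hf.continuous.locallyIntegrable hfs hB (fun n => (F_test n).memLp) f_mem).prodMk_nhds
    (tendsto_toLp_normed_convolution ENNReal.ofNat_ne_top ρ_le ρ_lim ρ_ratio
      (locallyIntegrable_grad_of_lipschitz hf) (hasCompactSupport_grad hfs)
      (norm_grad_le_of_lipschitz hf) grad_F_mem grad_mem))
    (Eventually.of_forall fun n => ⟨_, F_test n, (F_test n).memLp.coeFn_toLp, ?_⟩)
  rw [grad_F n]
  exact (grad_F_mem n).coeFn_toLp

end Lipschitz

/-! ### Folding a test function across an interface -/

section Fold

open Filter Topology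
open scoped NNReal

theorem inter_frontier_nonempty {X : Type*} [TopologicalSpace X] {S C : Set X} {x y : X}
    (hS : IsPreconnected S) (hx : x ∈ S) (hxC : x ∈ C) (hy : y ∈ S) (hyC : y ∉ C) :
    (S ∩ frontier C).Nonempty := by
  by_contra! h
  have notMem_frontier {z : X} (hz : z ∈ S) : z ∉ frontier C := fun hzC => h.subset ⟨hz, hzC⟩
  have mem_interior {z : X} (hz : z ∈ S) (hzC : z ∈ closure C) : z ∈ interior C :=
    by_contra fun hzi => notMem_frontier hz ⟨hzC, hzi⟩
  obtain ⟨z, -, hz, hz'⟩ := hS (interior C) (closure C)ᶜ isOpen_interior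
    isClosed_closure.isOpen_compl
    (fun z hz => (em (z ∈ closure C)).imp_left (mem_interior hz))
    ⟨x, hx, mem_interior hx (subset_closure hxC)⟩
    ⟨y, hy, fun hyC' => hyC (interior_subset (mem_interior hy hyC'))⟩
  exact hz' (interior_subset_closure hz)

theorem lipschitzWith_indicator {E F : Type*} [NormedAddCommGroup E] [NormedSpace ℝ E]
    [NormedAddCommGroup F] {f : E → F} {K : ℝ≥0} (hf : LipschitzWith K f) {C : Set E}
    (hC : ∀ x ∈ frontier C, f x = 0) : LipschitzWith K (C.indicator f) := by
  have norm_le {x y : E} (hx : x ∈ C) (hy : y ∉ C) : ‖f x‖ ≤ K * dist x y := by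
    obtain ⟨z, hz, hzC⟩ := inter_frontier_nonempty (convex_segment (𝕜 := ℝ) x y).isPreconnected
      (left_mem_segment ℝ x y) hx (right_mem_segment ℝ x y) hy
    calc ‖f x‖ = dist (f x) (f z) := by rw [hC z hzC, dist_zero_right]
      _ ≤ K * dist x z := hf.dist_le_mul x z
      _ ≤ K * dist x y := by
        rw [← dist_add_dist_of_mem_segment hz]
        gcongr
        exact le_add_of_nonneg_right dist_nonneg
  refine LipschitzWith.of_dist_le_mul fun x y => ?_
  by_cases hx : x ∈ C <;> by_cases hy : y ∈ C
  · simpa only [indicator_of_mem, hx, hy] using hf.dist_le_mul x y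
  · simpa only [indicator_of_mem hx, indicator_of_notMem hy, dist_zero_right] using norm_le hx hy
  · simpa only [indicator_of_mem hy, indicator_of_notMem hx, dist_zero_left, dist_comm x]
      using norm_le hy hx
  · simp only [indicator_of_notMem, hx, hy, not_false_eq_true, dist_self]
    positivity

theorem grad_const_smul_sub (c : ℂ) {φ ψ : Plane → ℂ} (hφ : Differentiable ℝ φ)
    (hψ : Differentiable ℝ ψ) : grad (c • (φ - ψ)) = c • (grad φ - grad ψ) := by
  funext x
  rw [grad_eq_gradOf, fderiv_const_smul ((hφ x).sub (hψ x)), fderiv_sub (hφ x) (hψ x)]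
  rfl

theorem grad_add_indicator {φ h : Plane → ℂ} (hφ : Differentiable ℝ φ) (hh : Differentiable ℝ h)
    {U : Set Plane} (hU : IsOpen U) {x : Plane} (hx : x ∉ frontier U) :
    grad (φ + U.indicator h) x = grad φ x + U.indicator (grad h) x := by
  by_cases hxU : x ∈ U
  · have heq : φ + U.indicator h =ᶠ[𝓝 x] φ + h := by
      filter_upwards [hU.mem_nhds hxU] with y hy
      simp only [Pi.add_apply, indicator_of_mem hy]
    rw [indicator_of_mem hxU, grad_eq_gradOf, heq.fderiv_eq, fderiv_add (hφ x) (hh x), map_add]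
    rfl
  · have hxU' : x ∈ (closure U)ᶜ := fun hx' => hx (hU.frontier_eq ▸ ⟨hx', hxU⟩)
    have heq : φ + U.indicator h =ᶠ[𝓝 x] φ := by
      filter_upwards [isClosed_closure.isOpen_compl.mem_nhds hxU'] with y hy
      rw [Pi.add_apply, indicator_of_notMem fun hyU => hy (subset_closure hyU), add_zero]
    rw [indicator_of_notMem hxU, add_zero, grad_eq_gradOf, heq.fderiv_eq]
    rfl

/-- `G` folds the part `U` of `Ω` onto the remaining part along their interface, with
quasiconformal dilatation at most `N`. The image of `U` may leave `Ω`, test functions being extended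
by zero, but a point of `closure U` must not enter `Ω` from outside. -/
structure IsFolding (Ω U : Set Plane) (G : Plane → Plane) (N : ℝ) : Prop where
  isOpen : IsOpen U
  subset : U ⊆ Ω
  volume_frontier : volume (frontier U ∩ Ω) = 0
  continuous : Continuous G
  norm_map : ∀ x, ‖G x‖ = ‖x‖
  contDiffAt : ∀ x ≠ 0, ContDiffAt ℝ ∞ G x
  zero_notMem : 0 ∉ Ω
  map_eq : ∀ x ∈ frontier U ∩ Ω, G x = x
  mem_of_map_mem : ∀ x ∈ closure U, G x ∈ Ω → x ∈ Ω
  mapsTo : MapsTo G U Uᶜ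
  injOn : InjOn G U
  sq_norm_fderiv_le : ∀ x ∈ U, ‖fderiv ℝ G x‖ ^ 2 ≤ N * |(fderiv ℝ G x).det|

namespace IsFolding

variable {Ω U : Set Plane} {G : Plane → Plane} {N : ℝ} {φ : Plane → ℂ}

theorem tsupport_comp_subset (hG : IsFolding Ω U G N) (φ : Plane → ℂ) :
    tsupport (φ ∘ G) ⊆ G ⁻¹' tsupport φ :=
  closure_minimal (fun _ hx => subset_tsupport φ hx)
    ((isClosed_tsupport φ).preimage hG.continuous)

theorem contDiff_comp (hG : IsFolding Ω U G N) (hφ : IsTestFunction Ω φ) :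
    ContDiff ℝ ∞ (φ ∘ G) := by
  refine contMDiff_iff_contDiff.1 (contMDiff_of_tsupport fun x hx => ContDiffAt.contMDiffAt ?_)
  refine hφ.smooth.contDiffAt.comp x (hG.contDiffAt x ?_)
  rintro rfl
  have hG0 : G 0 = 0 := by rw [← norm_eq_zero, hG.norm_map, norm_zero]
  exact hG.zero_notMem (hG0 ▸ hφ.support (hG.tsupport_comp_subset φ hx))

theorem hasCompactSupport_comp (hG : IsFolding Ω U G N) (hφ : HasCompactSupport φ) :
    HasCompactSupport (φ ∘ G) := by
  obtain ⟨R, hR⟩ := hφ.isCompact.isBounded.exists_norm_le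
  refine (isCompact_closedBall (0 : Plane) R).of_isClosed_subset (isClosed_tsupport _)
    fun x hx => ?_
  rw [mem_closedBall_zero_iff, ← hG.norm_map]
  exact hR _ (hG.tsupport_comp_subset φ hx)

theorem isTestFunction_comp (hG : IsFolding Ω U G N) (hφ : IsTestFunction Ω φ) :
    IsTestFunction univ (φ ∘ G) :=
  ⟨hG.contDiff_comp hφ, hG.hasCompactSupport_comp hφ.compact, subset_univ _⟩

theorem comp_eq_of_mem_frontier (hG : IsFolding Ω U G N) (hφ : IsTestFunction Ω φ) {x : Plane}
    (hx : x ∈ frontier U) : φ (G x) = φ x := by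
  by_cases hxΩ : x ∈ Ω
  · rw [hG.map_eq x ⟨hx, hxΩ⟩]
  · rw [hφ.eq_zero_of_notMem hxΩ, hφ.eq_zero_of_notMem fun hGx =>
      hxΩ (hG.mem_of_map_mem x (frontier_subset_closure hx) hGx)]

/-- The reflected function `2 φ ∘ G - φ` on `U`, continued by `φ`. -/
def fold (U : Set Plane) (G : Plane → Plane) (φ : Plane → ℂ) : Plane → ℂ :=
  φ + U.indicator ((2 : ℂ) • (φ ∘ G - φ))

theorem exists_lipschitzWith_fold (hG : IsFolding Ω U G N) (hφ : IsTestFunction Ω φ) :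
    ∃ K, LipschitzWith K (fold U G φ) := by
  have hψ := hG.isTestFunction_comp hφ
  obtain ⟨K, hK⟩ := hφ.smooth.lipschitzWith_of_hasCompactSupport hφ.compact (by simp)
  obtain ⟨K', hK'⟩ := ContDiff.lipschitzWith_of_hasCompactSupport
    (f := (2 : ℂ) • (φ ∘ G - φ)) (n := ∞) (𝕂 := ℝ) (hψ.compact.sub hφ.compact).smul_left
    (contDiff_const.smul (hψ.smooth.sub hφ.smooth)) (by simp)
  refine ⟨K + K', hK.add (lipschitzWith_indicator hK' fun x hx => ?_)⟩
  simp [hG.comp_eq_of_mem_frontier hφ hx]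

theorem tsupport_fold_subset (U : Set Plane) (G : Plane → Plane) (φ : Plane → ℂ) :
    tsupport (fold U G φ) ⊆ tsupport φ ∪ closure U ∩ tsupport (φ ∘ G) := by
  refine closure_minimal (fun x hx => ?_)
    ((isClosed_tsupport φ).union (isClosed_closure.inter (isClosed_tsupport _)))
  by_contra! hx'
  have hφx : φ x = 0 := image_eq_zero_of_notMem_tsupport fun h => hx' (Or.inl h)
  refine hx ?_
  by_cases hxU : x ∈ U
  · have hψx : (φ ∘ G) x = 0 :=
      image_eq_zero_of_notMem_tsupport fun h => hx' (Or.inr ⟨subset_closure hxU, h⟩)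
    rw [Function.comp_apply] at hψx
    simp [fold, hxU, hφx, hψx]
  · simp [fold, hxU, hφx]

theorem exists_H10_fold (hG : IsFolding Ω U G N) (hΩ : IsOpen Ω) (hφ : IsTestFunction Ω φ) :
    ∃ v : H10 Ω, v.gradient =ᵐ[volume.restrict Ω]
      grad φ + U.indicator ((2 : ℂ) • (grad (φ ∘ G) - grad φ)) := by
  have hψ := hG.isTestFunction_comp hφ
  obtain ⟨K, hK⟩ := hG.exists_lipschitzWith_fold hφ
  have hsub := tsupport_fold_subset U G φ
  have hcompact : HasCompactSupport (fold U G φ) :=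
    (hφ.compact.isCompact.union (hψ.compact.isCompact.inter_left isClosed_closure))
      |>.of_isClosed_subset (isClosed_tsupport _) hsub
  obtain ⟨v, hv⟩ := exists_H10_of_lipschitz hΩ hK hcompact <| hsub.trans <|
    union_subset hφ.support fun x hx =>
      hG.mem_of_map_mem x hx.1 (hφ.support (hG.tsupport_comp_subset φ hx.2))
  refine ⟨v, hv.trans ?_⟩
  have hfrontier : ∀ᵐ x ∂volume.restrict Ω, x ∉ frontier U := by
    rw [← measure_eq_zero_iff_ae_notMem, Measure.restrict_apply isClosed_frontier.measurableSet]
    exact hG.volume_frontier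
  have hφd := hφ.smooth.differentiable (by simp)
  have hψd := hψ.smooth.differentiable (by simp)
  filter_upwards [hfrontier] with x hx
  rw [fold, grad_add_indicator hφd ((hψd.sub hφd).const_smul (2 : ℂ)) hG.isOpen hx,
    grad_const_smul_sub 2 hψd hφd]
  rfl

end IsFolding

end Fold

section FoldEnergy

variable {Ω U : Set Plane} {G : Plane → Plane} {N : ℝ} {φ : Plane → ℂ}

theorem setIntegral_sq_norm_grad_comp_le_image (hφ : Differentiable ℝ φ)
    (hφint : Integrable fun x => ‖grad φ x‖ ^ 2) (hU : MeasurableSet U)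
    (hG : ∀ x ∈ U, DifferentiableAt ℝ G x) (hinj : InjOn G U)
    (hN : ∀ x ∈ U, ‖fderiv ℝ G x‖ ^ 2 ≤ N * |(fderiv ℝ G x).det|) :
    ∫ x in U, ‖grad (φ ∘ G) x‖ ^ 2 ≤ N * ∫ x in G '' U, ‖grad φ x‖ ^ 2 := by
  have hG' : ∀ x ∈ U, HasFDerivWithinAt G (fderiv ℝ G x) U x := fun x hx =>
    (hG x hx).hasFDerivAt.hasFDerivWithinAt
  have hint := (integrableOn_image_iff_integrableOn_abs_det_fderiv_smul volume hU hG' hinj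
    fun x => ‖grad φ x‖ ^ 2).1 hφint.integrableOn
  rw [integral_image_eq_integral_abs_det_fderiv_smul volume hU hG' hinj, ← integral_const_mul]
  refine integral_mono_of_nonneg (ae_of_all _ fun x => by positivity) (hint.const_mul N) ?_
  filter_upwards [ae_restrict_mem hU] with x hx
  calc ‖grad (φ ∘ G) x‖ ^ 2
      = ‖gradOf ((fderiv ℝ φ (G x)).comp (fderiv ℝ G x))‖ ^ 2 := by
        rw [grad_eq_gradOf, fderiv_comp x (hφ (G x)) (hG x hx)]
    _ ≤ (‖fderiv ℝ G x‖ * ‖grad φ (G x)‖) ^ 2 := by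
        gcongr
        exact norm_gradOf_comp_le _ _
    _ = ‖fderiv ℝ G x‖ ^ 2 * ‖grad φ (G x)‖ ^ 2 := mul_pow _ _ 2
    _ ≤ N * |(fderiv ℝ G x).det| * ‖grad φ (G x)‖ ^ 2 := by
        gcongr
        exact hN x hx
    _ = N * (|(fderiv ℝ G x).det| • ‖grad φ (G x)‖ ^ 2) := by rw [smul_eq_mul, mul_assoc]

theorem IsFolding.setIntegral_sq_norm_grad_comp_le (hG : IsFolding Ω U G N) (hN : 0 ≤ N)
    (hφ : IsTestFunction Ω φ) :
    ∫ x in U, ‖grad (φ ∘ G) x‖ ^ 2 ≤ N * ∫ x in Ω \ U, ‖grad φ x‖ ^ 2 := by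
  have hint : Integrable fun x => ‖grad φ x‖ ^ 2 := hφ.memLp_grad.integrable_norm_pow two_ne_zero
  have hdiff : ∀ x ∈ U, DifferentiableAt ℝ G x := fun x hx =>
    (hG.contDiffAt x (ne_of_mem_of_not_mem (hG.subset hx) hG.zero_notMem)).differentiableAt
      (by simp)
  have himage : ∫ x in G '' U, ‖grad φ x‖ ^ 2 ≤ ∫ x in Uᶜ, ‖grad φ x‖ ^ 2 :=
    setIntegral_mono_set hint.integrableOn (ae_of_all _ fun x => by positivity)
      (ae_of_all _ (image_subset_iff.2 hG.mapsTo))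
  have hsupport : ∫ x in Uᶜ, ‖grad φ x‖ ^ 2 = ∫ x in Ω \ U, ‖grad φ x‖ ^ 2 := by
    refine setIntegral_eq_of_subset_of_forall_sdiff_eq_zero hG.isOpen.measurableSet.compl
      (fun x hx => hx.2) fun x hx => ?_
    have hx0 : fderiv ℝ φ x = 0 :=
      Function.notMem_support.1 fun h => hx.2 ⟨hφ.support_fderiv_subset h, hx.1⟩
    rw [grad_eq_gradOf, hx0, map_zero, norm_zero, zero_pow two_ne_zero]
  calc ∫ x in U, ‖grad (φ ∘ G) x‖ ^ 2
      ≤ N * ∫ x in G '' U, ‖grad φ x‖ ^ 2 :=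
        setIntegral_sq_norm_grad_comp_le_image (hφ.smooth.differentiable (by simp)) hint
          hG.isOpen.measurableSet hdiff hG.injOn hG.sq_norm_fderiv_le
    _ ≤ N * ∫ x in Ω \ U, ‖grad φ x‖ ^ 2 := by
        rw [← hsupport]
        gcongr

end FoldEnergy

/-! ### T-coercivity -/

section TCoercivity

theorem norm_le_of_coercive_of_norm_le {𝕜 X : Type*} [RCLike 𝕜] [SeminormedAddCommGroup X]
    [NormedSpace 𝕜 X] {ℓ : X →L⋆[𝕜] 𝕜} {u v : X} {m D : ℝ} (hm : 0 < m) (hD : 0 ≤ D)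
    (hcoercive : m * ‖u‖ ^ 2 ≤ ‖ℓ v‖) (hv : ‖v‖ ≤ D * ‖u‖) : ‖u‖ ≤ D / m * ‖ℓ‖ := by
  rcases (norm_nonneg u).eq_or_lt with hu | hu
  · rw [← hu]
    positivity
  · rw [div_mul_eq_mul_div, le_div_iff₀ hm]
    refine le_of_mul_le_mul_right ?_ hu
    calc ‖u‖ * m * ‖u‖ = m * ‖u‖ ^ 2 := by ring
      _ ≤ ‖ℓ‖ * ‖v‖ := hcoercive.trans (ℓ.le_opNorm v)
      _ ≤ ‖ℓ‖ * (D * ‖u‖) := by gcongr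
      _ = D * ‖ℓ‖ * ‖u‖ := by ring

variable {𝕜 E : Type*} [RCLike 𝕜] [NormedAddCommGroup E] [InnerProductSpace 𝕜 E]

open RCLike

theorem two_mul_re_inner_le (p q : E) {η : ℝ} (hη : 0 < η) :
    2 * re (inner 𝕜 p q) ≤ η * ‖q‖ ^ 2 + ‖p‖ ^ 2 / η := by
  have hsq : η * ‖q‖ ^ 2 + ‖p‖ ^ 2 / η - 2 * (‖p‖ * ‖q‖) = (η * ‖q‖ - ‖p‖) ^ 2 / η := by
    field_simp
    ring
  have hnonneg : 0 ≤ (η * ‖q‖ - ‖p‖) ^ 2 / η := by positivity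
  linarith [re_inner_le_norm (𝕜 := 𝕜) p q]

theorem sq_norm_add_two_smul_sub_le (p q : E) :
    ‖p + (2 : 𝕜) • (q - p)‖ ^ 2 ≤ 2 * ‖p‖ ^ 2 + 8 * ‖q‖ ^ 2 := by
  have h : ‖p + (2 : 𝕜) • (q - p)‖ ≤ ‖p‖ + 2 * ‖q‖ :=
    calc ‖p + (2 : 𝕜) • (q - p)‖ = ‖(2 : 𝕜) • q - p‖ := by
          congr 1
          module
      _ ≤ ‖(2 : 𝕜) • q‖ + ‖p‖ := norm_sub_le _ _
      _ = ‖p‖ + 2 * ‖q‖ := by rw [norm_smul, norm_ofNat, add_comm]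
  have hsq := pow_le_pow_left₀ (norm_nonneg _) h 2
  nlinarith [sq_nonneg (‖p‖ - 2 * ‖q‖)]

theorem neg_mul_re_inner_add_two_smul_sub_ge (p q : E) {b η : ℝ} (hb : 0 ≤ b) (hη : 0 < η) :
    (1 - η) * b * ‖p‖ ^ 2 - b / η * ‖q‖ ^ 2 ≤ -b * re (inner 𝕜 (p + (2 : 𝕜) • (q - p)) p) := by
  have hinner : re (inner 𝕜 (p + (2 : 𝕜) • (q - p)) p) = 2 * re (inner 𝕜 q p) - ‖p‖ ^ 2 := by
    rw [← inner_self_eq_norm_sq (𝕜 := 𝕜) p, inner_add_left, inner_smul_left, inner_sub_left,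
      map_ofNat]
    simp only [map_add, map_sub, ofNat_mul_re, mul_sub]
    ring
  calc (1 - η) * b * ‖p‖ ^ 2 - b / η * ‖q‖ ^ 2
      = b * (‖p‖ ^ 2 - (η * ‖p‖ ^ 2 + ‖q‖ ^ 2 / η)) := by ring
    _ ≤ b * (‖p‖ ^ 2 - 2 * re (inner 𝕜 q p)) := by
        gcongr
        exact two_mul_re_inner_le q p hη
    _ = -b * re (inner 𝕜 (p + (2 : 𝕜) • (q - p)) p) := by
        rw [hinner]
        ring

variable {α : Type*} [MeasurableSpace α] {μ : Measure α} {f g h : α → E} {U : Set α} {N : ℝ}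

theorem integral_sq_norm_fold_le (hU : MeasurableSet U) (hf : MemLp f 2 μ) (hh : MemLp h 2 μ)
    (hg : g =ᵐ[μ] f + U.indicator ((2 : 𝕜) • (h - f))) (hN : 0 ≤ N)
    (hfh : ∫ x in U, ‖h x‖ ^ 2 ∂μ ≤ N * ∫ x in Uᶜ, ‖f x‖ ^ 2 ∂μ) :
    ∫ x, ‖g x‖ ^ 2 ∂μ ≤ (2 + 8 * N) * ∫ x, ‖f x‖ ^ 2 ∂μ := by
  have hf2 := hf.integrable_norm_pow two_ne_zero
  have hh2 := hh.integrable_norm_pow two_ne_zero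
  have hle : (fun x => ‖g x‖ ^ 2) ≤ᵐ[μ]
      fun x => 2 * ‖f x‖ ^ 2 + U.indicator (fun x => 8 * ‖h x‖ ^ 2) x := by
    filter_upwards [hg] with x hx
    rw [hx, Pi.add_apply]
    by_cases hxU : x ∈ U
    · rw [indicator_of_mem hxU, indicator_of_mem hxU]
      exact sq_norm_add_two_smul_sub_le (f x) (h x)
    · simp only [indicator_of_notMem hxU, add_zero]
      linarith [sq_nonneg ‖f x‖]
  have hcompl : ∫ x in Uᶜ, ‖f x‖ ^ 2 ∂μ ≤ ∫ x, ‖f x‖ ^ 2 ∂μ :=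
    setIntegral_le_integral hf2 (ae_of_all _ fun x => by positivity)
  calc ∫ x, ‖g x‖ ^ 2 ∂μ
      ≤ ∫ x, 2 * ‖f x‖ ^ 2 + U.indicator (fun x => 8 * ‖h x‖ ^ 2) x ∂μ :=
        integral_mono_of_nonneg (ae_of_all _ fun x => by positivity)
          ((hf2.const_mul 2).add ((hh2.const_mul 8).indicator hU)) hle
    _ = 2 * ∫ x, ‖f x‖ ^ 2 ∂μ + 8 * ∫ x in U, ‖h x‖ ^ 2 ∂μ := by
        rw [integral_add (hf2.const_mul 2) ((hh2.const_mul 8).indicator hU),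
          integral_indicator hU, integral_const_mul, integral_const_mul]
    _ ≤ 2 * ∫ x, ‖f x‖ ^ 2 ∂μ + 8 * (N * ∫ x, ‖f x‖ ^ 2 ∂μ) := by
        gcongr
        exact hfh.trans (mul_le_mul_of_nonneg_left hcompl hN)
    _ = (2 + 8 * N) * ∫ x, ‖f x‖ ^ 2 ∂μ := by ring

theorem integral_mul_re_inner_fold_ge {τ : α → ℝ} {a b η m : ℝ} (hU : MeasurableSet U)
    (hf : MemLp f 2 μ) (hh : MemLp h 2 μ) (hg : g =ᵐ[μ] f + U.indicator ((2 : 𝕜) • (h - f)))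
    (hτU : ∀ᵐ x ∂μ, x ∈ U → τ x = -b) (hτUc : ∀ᵐ x ∂μ, x ∉ U → τ x = a)
    (hint : Integrable (fun x => τ x * re (inner 𝕜 (g x) (f x))) μ)
    (hb : 0 ≤ b) (hη : 0 < η) (hab : N * b ≤ η ^ 2 * a) (hma : m ≤ (1 - η) * a)
    (hmb : m ≤ (1 - η) * b) (hfh : ∫ x in U, ‖h x‖ ^ 2 ∂μ ≤ N * ∫ x in Uᶜ, ‖f x‖ ^ 2 ∂μ) :
    m * ∫ x, ‖f x‖ ^ 2 ∂μ ≤ ∫ x, τ x * re (inner 𝕜 (g x) (f x)) ∂μ := by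
  have hf2 := hf.integrable_norm_pow two_ne_zero
  have hh2 := hh.integrable_norm_pow two_ne_zero
  have hfUc := (hf2.const_mul (η * a)).indicator hU.compl
  have hhU := (hh2.const_mul (b / η)).indicator hU
  have hfold : b / η * ∫ x in U, ‖h x‖ ^ 2 ∂μ ≤ η * a * ∫ x in Uᶜ, ‖f x‖ ^ 2 ∂μ :=
    calc b / η * ∫ x in U, ‖h x‖ ^ 2 ∂μ ≤ b / η * (N * ∫ x in Uᶜ, ‖f x‖ ^ 2 ∂μ) := by gcongr
      _ = N * b / η * ∫ x in Uᶜ, ‖f x‖ ^ 2 ∂μ := by ring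
      _ ≤ η * a * ∫ x in Uᶜ, ‖f x‖ ^ 2 ∂μ := by
        gcongr
        rw [div_le_iff₀ hη]
        linarith
  calc m * ∫ x, ‖f x‖ ^ 2 ∂μ
      ≤ m * ∫ x, ‖f x‖ ^ 2 ∂μ + η * a * ∫ x in Uᶜ, ‖f x‖ ^ 2 ∂μ
        - b / η * ∫ x in U, ‖h x‖ ^ 2 ∂μ := by linarith
    _ = ∫ x, ((fun x => m * ‖f x‖ ^ 2) + Uᶜ.indicator (fun x => η * a * ‖f x‖ ^ 2)
        - U.indicator fun x => b / η * ‖h x‖ ^ 2) x ∂μ := by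
      rw [integral_sub' ((hf2.const_mul m).add hfUc) hhU, integral_add' (hf2.const_mul m) hfUc,
        integral_indicator hU, integral_indicator hU.compl]
      simp only [integral_const_mul]
    _ ≤ ∫ x, τ x * re (inner 𝕜 (g x) (f x)) ∂μ := by
      refine integral_mono_ae (((hf2.const_mul m).add hfUc).sub hhU) hint ?_
      filter_upwards [hg, hτU, hτUc] with x hgx hτx hτx'
      rw [hgx, Pi.sub_apply, Pi.add_apply, Pi.add_apply]
      by_cases hxU : x ∈ U
      · rw [indicator_of_notMem (not_not_intro hxU), indicator_of_mem hxU, indicator_of_mem hxU,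
          hτx hxU, add_zero]
        refine le_trans ?_ (neg_mul_re_inner_add_two_smul_sub_ge (f x) (h x) hb hη)
        gcongr
      · rw [indicator_of_notMem hxU, indicator_of_notMem hxU, indicator_of_mem (mem_compl hxU),
          hτx' hxU, add_zero, sub_zero, inner_self_eq_norm_sq]
        linarith [mul_le_mul_of_nonneg_right hma (sq_nonneg ‖f x‖)]

end TCoercivity

section UniformBound

/-- The stability constant that T-coercivity yields for a folding of dilatation `N` across an
interface with coefficients `a` and `-b`. It is meaningful when `N * b < a`. -/
def foldConst (N a b : ℝ) : ℝ :=
  √(2 + 8 * N) / ((1 - √(N * b / a)) * min a b)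

theorem foldConst_pos {N a b : ℝ} (hN : 0 < N) (hb : 0 < b) (hab : N * b < a) :
    0 < foldConst N a b := by
  have ha : 0 < a := (mul_pos hN hb).trans hab
  have hη : √(N * b / a) < 1 := by
    rwa [Real.sqrt_lt' one_pos, one_pow, div_lt_one ha]
  exact div_pos (Real.sqrt_pos.2 (by linarith)) (mul_pos (sub_pos.2 hη) (lt_min ha hb))

theorem sq_norm_Lp_eq_integral {𝕜 α E : Type*} [RCLike 𝕜] [MeasurableSpace α] {μ : Measure α}
    [NormedAddCommGroup E] [InnerProductSpace 𝕜 E] (f : Lp E 2 μ) :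
    ‖f‖ ^ 2 = ∫ x, ‖f x‖ ^ 2 ∂μ := by
  have h : inner 𝕜 f f = ∫ x, inner 𝕜 (f x) (f x) ∂μ := L2.inner_def f f
  simp only [inner_self_eq_norm_sq_to_K] at h
  exact_mod_cast h

theorem IsTestFunction.sq_norm_toH10 {Ω : Set Plane} {φ : Plane → ℂ} (hφ : IsTestFunction Ω φ) :
    ‖hφ.toH10‖ ^ 2 = ∫ x in Ω, ‖grad φ x‖ ^ 2 := by
  rw [H10.norm_def, sq_norm_Lp_eq_integral (𝕜 := ℂ)]
  exact integral_congr_ae (hφ.gradient_toH10.mono fun x hx => by simp only [hx])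

theorem mul_re_A_toH10 {σp σm δ s : ℝ} {φ : Plane → ℂ} (hφ : IsTestFunction (Omega δ) φ)
    (v : H10 (Omega δ)) :
    Integrable (fun x => s * sigma σp σm δ x * (inner ℂ (v.gradient x) (grad φ x)).re)
        (volume.restrict (Omega δ)) ∧
      s * (A σp σm δ hφ.toH10 v).re =
        ∫ x in Omega δ, s * sigma σp σm δ x * (inner ℂ (v.gradient x) (grad φ x)).re := by
  have hform := integrable_form σp σm δ hφ.toH10 v
  have hcongr : (fun x => s * ((sigma σp σm δ x : ℂ) *
      inner ℂ (v.gradient x) (hφ.toH10.gradient x)).re) =ᵐ[volume.restrict (Omega δ)]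
      fun x => s * sigma σp σm δ x * (inner ℂ (v.gradient x) (grad φ x)).re := by
    filter_upwards [hφ.gradient_toH10] with x hx
    rw [hx, Complex.re_ofReal_mul, mul_assoc]
  refine ⟨(hform.re.const_mul s).congr hcongr, ?_⟩
  rw [← integral_congr_ae hcongr, integral_const_mul, A_apply]
  exact congrArg (s * ·) (integral_re hform).symm

theorem norm_toH10_le_of_isFolding {σp σm δ s a b N : ℝ} {U : Set Plane} {G : Plane → Plane}
    {φ : Plane → ℂ} (hΩ : IsOpen (Omega δ)) (hG : IsFolding (Omega δ) U G N) (hs : |s| = 1)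
    (hN : 0 < N) (hb : 0 < b) (hab : N * b < a)
    (hσU : ∀ᵐ x ∂volume.restrict (Omega δ), x ∈ U → s * sigma σp σm δ x = -b)
    (hσUc : ∀ᵐ x ∂volume.restrict (Omega δ), x ∉ U → s * sigma σp σm δ x = a)
    (hφ : IsTestFunction (Omega δ) φ) :
    ‖hφ.toH10‖ ≤ foldConst N a b * ‖A σp σm δ hφ.toH10‖ := by
  have ha : 0 < a := (mul_pos hN hb).trans hab
  have hU := hG.isOpen.measurableSet
  obtain ⟨v, hv⟩ := hG.exists_H10_fold hΩ hφ
  have hf := hφ.memLp_grad.restrict (Omega δ)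
  have hh := (hG.isTestFunction_comp hφ).memLp_grad.restrict (Omega δ)
  have hfold : ∫ x in U, ‖grad (φ ∘ G) x‖ ^ 2 ∂volume.restrict (Omega δ) ≤
      N * ∫ x in Uᶜ, ‖grad φ x‖ ^ 2 ∂volume.restrict (Omega δ) := by
    rw [Measure.restrict_restrict hU, Measure.restrict_restrict hU.compl,
      inter_eq_left.2 hG.subset, inter_comm, ← sdiff_eq]
    exact hG.setIntegral_sq_norm_grad_comp_le hN.le hφ
  set η := √(N * b / a)
  have hη : 0 < η := by positivity
  have hη1 : η < 1 := by
    rwa [Real.sqrt_lt' one_pos, one_pow, div_lt_one ha]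
  have hηab : N * b ≤ η ^ 2 * a := by
    rw [Real.sq_sqrt (by positivity), div_mul_cancel₀ _ ha.ne']
  have hη0 : 0 ≤ 1 - η := (sub_pos.2 hη1).le
  have hcoercive : (1 - η) * min a b * ‖hφ.toH10‖ ^ 2 ≤ ‖A σp σm δ hφ.toH10 v‖ := by
    obtain ⟨hint, hA⟩ := mul_re_A_toH10 (σp := σp) (σm := σm) (s := s) hφ v
    calc (1 - η) * min a b * ‖hφ.toH10‖ ^ 2 ≤ s * (A σp σm δ hφ.toH10 v).re := by
          rw [hφ.sq_norm_toH10, hA]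
          exact integral_mul_re_inner_fold_ge hU hf hh hv hσU hσUc hint hb.le hη hηab
            (mul_le_mul_of_nonneg_left (min_le_left a b) hη0)
            (mul_le_mul_of_nonneg_left (min_le_right a b) hη0) hfold
      _ ≤ |s| * |(A σp σm δ hφ.toH10 v).re| := (le_abs_self _).trans_eq (abs_mul _ _)
      _ ≤ ‖A σp σm δ hφ.toH10 v‖ := by
          rw [hs, one_mul]
          exact Complex.abs_re_le_norm _
  have hnorm : ‖v‖ ≤ √(2 + 8 * N) * ‖hφ.toH10‖ := by
    rw [← sq_le_sq₀ (norm_nonneg _) (by positivity), mul_pow, Real.sq_sqrt (by linarith),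
      hφ.sq_norm_toH10, H10.norm_def, sq_norm_Lp_eq_integral (𝕜 := ℂ)]
    exact integral_sq_norm_fold_le hU hf hh hv hN.le hfold
  exact norm_le_of_coercive_of_norm_le (mul_pos (sub_pos.2 hη1) (lt_min ha hb)) (by positivity)
    hcoercive hnorm

theorem norm_le_mul_norm_A_of_isFolding {σp σm δ s a b N : ℝ} {U : Set Plane} {G : Plane → Plane}
    (hΩ : IsOpen (Omega δ)) (hG : IsFolding (Omega δ) U G N) (hs : |s| = 1)
    (hN : 0 < N) (hb : 0 < b) (hab : N * b < a)
    (hσU : ∀ᵐ x ∂volume.restrict (Omega δ), x ∈ U → s * sigma σp σm δ x = -b)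
    (hσUc : ∀ᵐ x ∂volume.restrict (Omega δ), x ∉ U → s * sigma σp σm δ x = a)
    (u : H10 (Omega δ)) : ‖u‖ ≤ foldConst N a b * ‖A σp σm δ u‖ := by
  refine (dense_test (Omega δ)).induction (P := fun u => ‖u‖ ≤ foldConst N a b * ‖A σp σm δ u‖)
    ?_ (isClosed_le continuous_norm (continuous_const.mul (A σp σm δ).continuous.norm)) u
  rintro _ ⟨φ, hφ, rfl⟩
  exact norm_toH10_le_of_isFolding hΩ hG hs hN hb hab hσU hσUc hφ

end UniformBound

/-! ### Polar geometry of the sectors -/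

section Sectors

open Real
open Complex (I arg)

/-- The identification of the plane with `ℂ`, through which polar angles are read off by
`Complex.arg`. -/
def toComplex : Plane ≃ₗᵢ[ℝ] ℂ := Complex.orthonormalBasisOneI.repr.symm

theorem toComplex_re (x : Plane) : (toComplex x).re = x 0 := by simp [toComplex]

theorem toComplex_im (x : Plane) : (toComplex x).im = x 1 := by simp [toComplex]

theorem toComplex_polar (r θ : ℝ) :
    toComplex !₂[r * cos θ, r * sin θ] = r * (Complex.cos θ + Complex.sin θ * I) := by
  apply Complex.ext <;> simp [toComplex_re, toComplex_im, Complex.cos_ofReal_re,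
    Complex.sin_ofReal_re]

theorem norm_polar {r : ℝ} (hr : 0 ≤ r) (θ : ℝ) : ‖(!₂[r * cos θ, r * sin θ] : Plane)‖ = r := by
  rw [← toComplex.norm_map, toComplex_polar, norm_mul, Complex.norm_cos_add_sin_mul_I, mul_one,
    Complex.norm_of_nonneg hr]

theorem arg_polar {r θ : ℝ} (hr : 0 < r) (hθ : θ ∈ Ioc (-π) π) :
    arg (toComplex !₂[r * cos θ, r * sin θ]) = θ := by
  rw [toComplex_polar, Complex.arg_mul_cos_add_sin_mul_I hr hθ]

theorem polar_norm_arg (x : Plane) :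
    !₂[‖x‖ * cos (arg (toComplex x)), ‖x‖ * sin (arg (toComplex x))] = x := by
  apply toComplex.injective
  rw [toComplex_polar, ← toComplex.norm_map x, Complex.norm_mul_cos_add_sin_mul_I]

theorem eq_of_norm_eq_of_arg_eq {x y : Plane} (hnorm : ‖x‖ = ‖y‖)
    (harg : arg (toComplex x) = arg (toComplex y)) : x = y := by
  rw [← polar_norm_arg x, hnorm, harg, polar_norm_arg]

variable {δ α β : ℝ}

theorem mem_sector_iff (hδ : 0 ≤ δ) (hα : -π ≤ α) (hβ : β ≤ π) {x : Plane} :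
    x ∈ sector δ α β ↔ ‖x‖ ∈ Ioo δ 1 ∧ arg (toComplex x) ∈ Ioo α β := by
  constructor
  · rintro ⟨⟨r, θ⟩, ⟨hr, hθ⟩, rfl⟩
    have hr0 : 0 < r := hδ.trans_lt hr.1
    exact ⟨by rwa [norm_polar hr0.le],
      by rwa [arg_polar hr0 ⟨hα.trans_lt hθ.1, hθ.2.le.trans hβ⟩]⟩
  · exact fun ⟨hnorm, harg⟩ => ⟨(‖x‖, arg (toComplex x)), ⟨hnorm, harg⟩, polar_norm_arg x⟩

theorem isOpen_sector (hδ : 0 ≤ δ) (hα : -π ≤ α) (hβ : β ≤ π) : IsOpen (sector δ α β) := by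
  have heq : sector δ α β = toComplex ⁻¹' (Complex.polarCoord.source ∩
      Complex.polarCoord ⁻¹' (Ioo δ 1 ×ˢ Ioo α β)) := by
    ext x
    simp only [mem_sector_iff hδ hα hβ, mem_preimage, mem_inter_iff, Complex.polarCoord_source,
      Complex.polarCoord_apply, toComplex.norm_map, mem_prod, Complex.mem_slitPlane_iff_arg]
    refine ⟨fun h => ⟨⟨(h.2.2.trans_le hβ).ne, ?_⟩, h⟩, And.right⟩
    exact toComplex.map_eq_zero_iff.not.2 (norm_pos_iff.1 (hδ.trans_lt h.1.1))
  rw [heq]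
  exact (Complex.polarCoord.isOpen_inter_preimage (isOpen_Ioo.prod isOpen_Ioo)).preimage
    toComplex.continuous

theorem closure_sector_subset (hδ : 0 < δ) (hα : -π < α) (hβ : β ≤ π) :
    closure (sector δ α β) ⊆ {x | arg (toComplex x) ∈ Icc α β} := by
  have hcont : Continuous fun p : ℝ × ℝ => (!₂[p.1 * cos p.2, p.1 * sin p.2] : Plane) := by
    fun_prop
  have hclosed := ((isCompact_Icc (a := δ) (b := 1)).prod
    (isCompact_Icc (a := α) (b := β))).image hcont |>.isClosed
  refine (closure_minimal (image_mono (prod_mono Ioo_subset_Icc_self Ioo_subset_Icc_self))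
    hclosed).trans ?_
  rintro _ ⟨⟨r, θ⟩, ⟨hr, hθ⟩, rfl⟩
  rwa [mem_ofPred_eq, arg_polar (hδ.trans_le hr.1) ⟨hα.trans_le hθ.1, hθ.2.trans hβ⟩]

theorem volume_sector_ne_top (hδ : 0 ≤ δ) (hα : -π ≤ α) (hβ : β ≤ π) :
    volume (sector δ α β) ≠ ⊤ :=
  ((measure_mono fun _ hx => mem_ball_zero_iff.2
    ((mem_sector_iff hδ hα hβ).1 hx).1.2).trans_lt measure_ball_lt_top).ne

theorem volume_arg_eq_pi_div_four : volume {x : Plane | arg (toComplex x) = π / 4} = 0 := by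
  let ℓ : Plane →ₗ[ℝ] ℝ :=
    (EuclideanSpace.proj 0 - EuclideanSpace.proj 1 : Plane →L[ℝ] ℝ).toLinearMap
  have hℓ : LinearMap.ker ℓ ≠ ⊤ := fun h => by
    simpa [ℓ] using LinearMap.congr_fun (LinearMap.ker_eq_top.1 h) (EuclideanSpace.single 0 1)
  refine measure_mono_null (fun x (hx : arg (toComplex x) = π / 4) => ?_)
    (Measure.addHaar_submodule volume _ hℓ)
  have hpolar := polar_norm_arg x
  rw [hx, cos_pi_div_four, sin_pi_div_four] at hpolar
  have hdiag : x 0 = x 1 := (congrArg (· 0) hpolar).symm.trans (congrArg (· 1) hpolar)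
  simpa [ℓ, sub_eq_zero] using hdiag

end Sectors

section FoldMap

open Real
open Complex (I arg)
open scoped ComplexConjugate

/-- The real linear map `h ↦ a h + b h̄`. As a Fréchet derivative it has the Wirtinger
derivatives `a` in `z` and `b` in `z̄`. -/
def wirtinger (a b : ℂ) : ℂ →L[ℝ] ℂ :=
  a • ContinuousLinearMap.id ℝ ℂ + b • (Complex.conjCLE : ℂ →L[ℝ] ℂ)

theorem wirtinger_apply (a b h : ℂ) : wirtinger a b h = a * h + b * conj h := by
  simp [wirtinger]

theorem norm_wirtinger_le (a b : ℂ) : ‖wirtinger a b‖ ≤ ‖a‖ + ‖b‖ := by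
  refine ContinuousLinearMap.opNorm_le_bound _ (by positivity) fun h => ?_
  calc ‖wirtinger a b h‖ ≤ ‖a * h‖ + ‖b * conj h‖ := wirtinger_apply a b h ▸ norm_add_le _ _
    _ = (‖a‖ + ‖b‖) * ‖h‖ := by rw [norm_mul, norm_mul, RCLike.norm_conj, add_mul]

theorem det_wirtinger (a b : ℂ) : (wirtinger a b).det = ‖a‖ ^ 2 - ‖b‖ ^ 2 := by
  rw [ContinuousLinearMap.det, ← LinearMap.det_toMatrix Complex.basisOneI, Matrix.det_fin_two]
  simp only [LinearMap.toMatrix_apply, Complex.coe_basisOneI, Complex.coe_basisOneI_repr,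
    ContinuousLinearMap.coe_coe, wirtinger_apply, ← Complex.normSq_eq_norm_sq,
    Complex.normSq_apply, Matrix.cons_val_zero, Matrix.cons_val_one, mul_one, map_one,
    Complex.conj_I, mul_neg, Complex.add_re, Complex.add_im, Complex.neg_re, Complex.neg_im,
    Complex.mul_re, Complex.mul_im, Complex.I_re, Complex.I_im]
  ring

/-- In polar coordinates about `0`, the map `(r, θ) ↦ (r, foldAngle m θ)`: it multiplies the
angle to the ray `θ = π / 4` by `-(2 * m + 1)`. -/
def complexFold (m : ℕ) (z : ℂ) : ℂ := (I * conj z) ^ (m + 1) / z ^ m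

/-- The effect of `complexFold m` on polar angles. -/
def foldAngle (m : ℕ) (θ : ℝ) : ℝ := π / 4 - (2 * m + 1) * (θ - π / 4)

theorem norm_complexFold (m : ℕ) (z : ℂ) : ‖complexFold m z‖ = ‖z‖ := by
  rcases eq_or_ne z 0 with rfl | hz
  · simp [complexFold]
  · rw [complexFold, norm_div, norm_pow, norm_mul, Complex.norm_I, RCLike.norm_conj, one_mul,
      norm_pow, pow_succ, mul_div_cancel_left₀ _ (pow_ne_zero m (norm_ne_zero_iff.2 hz))]

theorem complexFold_polar (m : ℕ) {r : ℝ} (hr : r ≠ 0) (θ : ℝ) :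
    complexFold m (r * Complex.exp (θ * I)) = r * Complex.exp (foldAngle m θ * I) := by
  have hrC : (r : ℂ) ≠ 0 := Complex.ofReal_ne_zero.2 hr
  have hconj : conj (r * Complex.exp (θ * I)) = r * Complex.exp (-(θ * I)) := by
    simp [← Complex.exp_conj]
  have hangle : foldAngle m θ * I = (m + 1 : ℕ) * (π / 2 * I + -(θ * I)) - m * (θ * I) := by
    push_cast [foldAngle]
    ring
  rw [complexFold, hconj, hangle, Complex.exp_sub, Complex.exp_nat_mul, Complex.exp_nat_mul,
    Complex.exp_add, Complex.exp_pi_div_two_mul_I]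
  simp only [mul_pow]
  field_simp
  rw [pow_succ]

theorem arg_complexFold (m : ℕ) {z : ℂ} (hz : z ≠ 0) (h : foldAngle m (arg z) ∈ Ioc (-π) π) :
    arg (complexFold m z) = foldAngle m (arg z) := by
  conv_lhs => rw [← Complex.norm_mul_exp_arg_mul_I z, complexFold_polar m (norm_ne_zero_iff.2 hz)]
  rw [Complex.arg_real_mul _ (norm_pos_iff.2 hz), Complex.arg_exp_mul_I,
    toIocMod_eq_self two_pi_pos |>.2 ?_]
  rwa [neg_add_eq_sub, two_mul, add_sub_cancel_right]

theorem hasFDerivAt_complexFold (m : ℕ) {z : ℂ} (hz : z ≠ 0) :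
    HasFDerivAt (complexFold m) (wirtinger (-m * (I * conj z) ^ (m + 1) / z ^ (m + 1))
      ((m + 1) * I * (I * conj z) ^ m / z ^ m)) z := by
  have hnum : HasFDerivAt (fun w : ℂ => (I * conj w) ^ (m + 1)) _ z :=
    ((Complex.conjCLE.hasFDerivAt (x := z)).const_mul I).pow (m + 1)
  have hden : HasFDerivAt (fun w : ℂ => w ^ (-m : ℤ)) _ z :=
    (hasDerivAt_zpow (-m) z (Or.inl hz)).hasFDerivAt.restrictScalars ℝ
  have heq : complexFold m = fun w => (I * conj w) ^ (m + 1) * w ^ (-m : ℤ) := by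
    funext w
    rw [complexFold, zpow_neg, zpow_natCast, div_eq_mul_inv]
  rw [heq]
  refine (hnum.mul hden).congr_fderiv (ContinuousLinearMap.ext fun h => ?_)
  rw [wirtinger_apply]
  simp only [Int.cast_neg, Int.cast_natCast, zpow_sub_one₀ hz, zpow_neg, zpow_natCast, neg_mul,
    ContinuousAlgEquiv.coeCLE_apply, Complex.conjCAE_apply, add_tsub_cancel_right, nsmul_eq_mul,
    Nat.cast_add, Nat.cast_one, add_apply, smul_apply, ContinuousLinearMap.coe_restrictScalars',
    ContinuousLinearMap.toSpanSingleton_apply, smul_eq_mul, mul_neg,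
    ContinuousLinearEquiv.coe_coe]
  field_simp
  ring

theorem contDiffAt_complexFold (m : ℕ) {z : ℂ} (hz : z ≠ 0) : ContDiffAt ℝ ∞ (complexFold m) z :=
  ((contDiffAt_const.mul Complex.conjCLE.contDiff.contDiffAt).pow (m + 1)).mul
    ((contDiffAt_id.pow m).inv (pow_ne_zero m hz))

theorem continuous_complexFold (m : ℕ) : Continuous (complexFold m) := by
  refine continuous_iff_continuousAt.2 fun z => ?_
  rcases eq_or_ne z 0 with rfl | hz
  · have hzero : complexFold m 0 = 0 := norm_eq_zero.1 ((norm_complexFold m 0).trans norm_zero)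
    rw [ContinuousAt, hzero, tendsto_zero_iff_norm_tendsto_zero]
    simpa only [norm_complexFold] using tendsto_norm_zero (E := ℂ)
  · exact (contDiffAt_complexFold m hz).continuousAt

theorem sq_norm_fderiv_complexFold_le (m : ℕ) {z : ℂ} (hz : z ≠ 0) :
    ‖fderiv ℝ (complexFold m) z‖ ^ 2 ≤ (2 * m + 1) * |(fderiv ℝ (complexFold m) z).det| := by
  have hz' : ‖z‖ ≠ 0 := norm_ne_zero_iff.2 hz
  have hnorm_m1 : ‖(m : ℂ) + 1‖ = m + 1 := by exact_mod_cast Complex.norm_natCast (m + 1)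
  have ha : ‖-m * (I * conj z) ^ (m + 1) / z ^ (m + 1)‖ = m := by
    simp [hz']
  have hb : ‖(m + 1) * I * (I * conj z) ^ m / z ^ m‖ = m + 1 := by
    simp [hz', hnorm_m1]
  have hnorm := norm_wirtinger_le (-m * (I * conj z) ^ (m + 1) / z ^ (m + 1))
    ((m + 1) * I * (I * conj z) ^ m / z ^ m)
  rw [(hasFDerivAt_complexFold m hz).fderiv, det_wirtinger, ha, hb, abs_of_nonpos (by nlinarith)]
  rw [ha, hb] at hnorm
  nlinarith [norm_nonneg (wirtinger (-m * (I * conj z) ^ (m + 1) / z ^ (m + 1))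
    ((m + 1) * I * (I * conj z) ^ m / z ^ m))]

/-- `complexFold m` as a map of the plane. -/
def planeFold (m : ℕ) (x : Plane) : Plane := toComplex.symm (complexFold m (toComplex x))

theorem norm_planeFold (m : ℕ) (x : Plane) : ‖planeFold m x‖ = ‖x‖ := by
  rw [planeFold, toComplex.symm.norm_map, norm_complexFold, toComplex.norm_map]

theorem arg_planeFold (m : ℕ) {x : Plane} (hx : x ≠ 0)
    (h : foldAngle m (arg (toComplex x)) ∈ Ioc (-π) π) :
    arg (toComplex (planeFold m x)) = foldAngle m (arg (toComplex x)) := by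
  rw [planeFold, toComplex.apply_symm_apply,
    arg_complexFold m (toComplex.map_eq_zero_iff.not.2 hx) h]

theorem contDiffAt_planeFold (m : ℕ) {x : Plane} (hx : x ≠ 0) :
    ContDiffAt ℝ ∞ (planeFold m) x :=
  toComplex.symm.contDiff.contDiffAt.comp x ((contDiffAt_complexFold m
    (toComplex.map_eq_zero_iff.not.2 hx)).comp x toComplex.contDiff.contDiffAt)

theorem continuous_planeFold (m : ℕ) : Continuous (planeFold m) :=
  toComplex.symm.continuous.comp ((continuous_complexFold m).comp toComplex.continuous)

theorem fderiv_planeFold (m : ℕ) (x : Plane) : fderiv ℝ (planeFold m) x =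
    (toComplex.symm : ℂ →L[ℝ] Plane) ∘L fderiv ℝ (complexFold m) (toComplex x) ∘L
      (toComplex : Plane →L[ℝ] ℂ) :=
  toComplex.symm.comp_fderiv.trans
    (congrArg _ (toComplex.toContinuousLinearEquiv.comp_right_fderiv (f := complexFold m)))

theorem sq_norm_fderiv_planeFold_le (m : ℕ) {x : Plane} (hx : x ≠ 0) :
    ‖fderiv ℝ (planeFold m) x‖ ^ 2 ≤ (2 * m + 1) * |(fderiv ℝ (planeFold m) x).det| := by
  have hnorm : ‖fderiv ℝ (planeFold m) x‖ = ‖fderiv ℝ (complexFold m) (toComplex x)‖ := by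
    rw [fderiv_planeFold]
    exact (toComplex.symm.toLinearIsometry.norm_toContinuousLinearMap_comp).trans
      (ContinuousLinearMap.opNorm_comp_linearIsometryEquiv _ toComplex)
  have hdet : (fderiv ℝ (planeFold m) x).det = (fderiv ℝ (complexFold m) (toComplex x)).det := by
    rw [fderiv_planeFold]
    exact LinearMap.det_conj (fderiv ℝ (complexFold m) (toComplex x) : ℂ →ₗ[ℝ] ℂ)
      toComplex.symm.toLinearEquiv
  rw [hnorm, hdet]
  exact sq_norm_fderiv_complexFold_le m (toComplex.map_eq_zero_iff.not.2 hx)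

end FoldMap

section SectorFolding

open Real
open Complex (arg)

variable {δ : ℝ}

theorem foldAngle_injective (m : ℕ) : Function.Injective (foldAngle m) := fun θ θ' h => by
  have hm : (2 * m + 1 : ℝ) ≠ 0 := by positivity
  exact sub_left_injective (mul_left_cancel₀ hm (sub_right_injective h))

theorem isOpen_Omega (hδ : 0 ≤ δ) : IsOpen (Omega δ) :=
  isOpen_sector hδ (neg_nonpos.2 pi_pos.le) le_rfl

theorem volume_Omega_ne_top (hδ : 0 ≤ δ) : volume (Omega δ) ≠ ⊤ :=
  volume_sector_ne_top hδ (neg_nonpos.2 pi_pos.le) le_rfl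

theorem mem_Omega_iff (hδ : 0 ≤ δ) {x : Plane} :
    x ∈ Omega δ ↔ ‖x‖ ∈ Ioo δ 1 ∧ arg (toComplex x) ∈ Ioo 0 π :=
  mem_sector_iff hδ (neg_nonpos.2 pi_pos.le) le_rfl

theorem arg_mem_of_mem_frontier_sector {α β : ℝ} (hδ : 0 < δ) (hα : -π < α) (hβ : β ≤ π)
    {x : Plane} (hx : x ∈ frontier (sector δ α β)) (hnorm : ‖x‖ ∈ Ioo δ 1) :
    arg (toComplex x) ∈ Icc α β \ Ioo α β := by
  rw [(isOpen_sector hδ.le hα.le hβ).frontier_eq] at hx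
  exact ⟨closure_sector_subset hδ hα hβ hx.1,
    fun h => hx.2 ((mem_sector_iff hδ.le hα.le hβ).2 ⟨hnorm, h⟩)⟩

theorem planeFold_eq_self (m : ℕ) {x : Plane} (hx : x ≠ 0) (harg : arg (toComplex x) = π / 4) :
    planeFold m x = x := by
  have hfix : foldAngle m (arg (toComplex x)) = arg (toComplex x) := by
    rw [harg, foldAngle, sub_self, mul_zero, sub_zero]
  refine eq_of_norm_eq_of_arg_eq (norm_planeFold m x) ?_
  rw [arg_planeFold m hx (hfix.symm ▸ Complex.arg_mem_Ioc _), hfix]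

theorem injOn_planeFold {m : ℕ} {S : Set ℝ} (hS : MapsTo (foldAngle m) S (Ioc (-π) π)) :
    InjOn (planeFold m) {x | x ≠ 0 ∧ arg (toComplex x) ∈ S} := by
  rintro x ⟨hx, hxS⟩ y ⟨hy, hyS⟩ hxy
  refine eq_of_norm_eq_of_arg_eq ?_ (foldAngle_injective m ?_)
  · rw [← norm_planeFold m x, hxy, norm_planeFold]
  · rw [← arg_planeFold m hx (hS hxS), hxy, arg_planeFold m hy (hS hyS)]

theorem isFolding_planeFold_sector {m : ℕ} {α β : ℝ} (hδ : 0 < δ) (hα : 0 ≤ α) (hβ : β ≤ π)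
    (hboundary : (Icc α β ∩ Ioo 0 π) \ Ioo α β ⊆ {π / 4})
    (hmapsTo : MapsTo (foldAngle m) (Icc α β) (Ioc (-π) π))
    (hdisjoint : MapsTo (foldAngle m) (Ioo α β) (Ioo α β)ᶜ)
    (hback : Icc α β ∩ foldAngle m ⁻¹' Ioo 0 π ⊆ Ioo 0 π) :
    IsFolding (Omega δ) (sector δ α β) (planeFold m) (2 * m + 1) := by
  have hα' : -π < α := by linarith [pi_pos]
  have mem_U {x : Plane} : x ∈ sector δ α β ↔ ‖x‖ ∈ Ioo δ 1 ∧ arg (toComplex x) ∈ Ioo α β :=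
    mem_sector_iff hδ.le hα'.le hβ
  have ne_zero {x : Plane} (hx : ‖x‖ ∈ Ioo δ 1) : x ≠ 0 := norm_pos_iff.1 (hδ.trans hx.1)
  have arg_fold {x : Plane} (hx : ‖x‖ ∈ Ioo δ 1) (hxU : arg (toComplex x) ∈ Icc α β) :
      arg (toComplex (planeFold m x)) = foldAngle m (arg (toComplex x)) :=
    arg_planeFold m (ne_zero hx) (hmapsTo hxU)
  have arg_frontier {x : Plane} (hx : x ∈ frontier (sector δ α β) ∩ Omega δ) :
      arg (toComplex x) = π / 4 := by
    obtain ⟨hnorm, harg⟩ := (mem_Omega_iff hδ.le).1 hx.2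
    have hedge := arg_mem_of_mem_frontier_sector hδ hα' hβ hx.1 hnorm
    exact hboundary ⟨⟨hedge.1, harg⟩, hedge.2⟩
  refine
    { isOpen := isOpen_sector hδ.le hα'.le hβ
      subset := fun x hx => (mem_Omega_iff hδ.le).2 ((mem_U.1 hx).imp_right fun h =>
        ⟨hα.trans_lt h.1, h.2.trans_le hβ⟩)
      volume_frontier := measure_mono_null (fun x => arg_frontier) volume_arg_eq_pi_div_four
      continuous := continuous_planeFold m
      norm_map := norm_planeFold m
      contDiffAt := fun x => contDiffAt_planeFold m
      zero_notMem := fun h => ne_zero ((mem_Omega_iff hδ.le).1 h).1 rfl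
      map_eq := fun x hx =>
        planeFold_eq_self m (ne_zero ((mem_Omega_iff hδ.le).1 hx.2).1) (arg_frontier hx)
      mem_of_map_mem := fun x hx hGx => ?_
      mapsTo := fun x hx hGx => ?_
      injOn := (injOn_planeFold hmapsTo).mono fun x hx =>
        (mem_U.1 hx).imp ne_zero fun h => Ioo_subset_Icc_self h
      sq_norm_fderiv_le := fun x hx => sq_norm_fderiv_planeFold_le m (ne_zero (mem_U.1 hx).1) }
  · have hxU := closure_sector_subset hδ hα' hβ hx
    obtain ⟨hnorm, harg⟩ := (mem_Omega_iff hδ.le).1 hGx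
    rw [norm_planeFold] at hnorm
    rw [arg_fold hnorm hxU] at harg
    exact (mem_Omega_iff hδ.le).2 ⟨hnorm, hback ⟨hxU, harg⟩⟩
  · obtain ⟨hnorm, harg⟩ := mem_U.1 hx
    exact hdisjoint harg (arg_fold hnorm (Ioo_subset_Icc_self harg) ▸ (mem_U.1 hGx).2)

theorem isFolding_OmegaPlus (hδ : 0 < δ) : IsFolding (Omega δ) (OmegaPlus δ) (planeFold 0) 1 := by
  have hπ := pi_pos
  have foldAngle_zero (θ : ℝ) : foldAngle 0 θ = π / 2 - θ := by
    rw [foldAngle]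
    push_cast
    ring
  have h := isFolding_planeFold_sector (m := 0) (α := π / 4) (β := π) hδ (by positivity) le_rfl
    (fun θ hθ => ?_) (fun θ hθ => ?_) (fun θ hθ hθ' => ?_) (fun θ hθ => ?_)
  · rw [Nat.cast_zero, mul_zero, zero_add] at h
    exact h
  · by_contra hne
    exact hθ.2 ⟨hθ.1.1.1.lt_of_ne' hne, hθ.1.2.2⟩
  · rw [foldAngle_zero]
    exact ⟨by linarith [hθ.2], by linarith [hθ.1]⟩
  · rw [foldAngle_zero] at hθ'
    linarith [hθ.1, hθ'.1]
  · have hθ' := hθ.2.1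
    rw [foldAngle_zero] at hθ'
    exact ⟨by linarith [hθ.1.1], by linarith⟩

theorem isFolding_OmegaMinus (hδ : 0 < δ) :
    IsFolding (Omega δ) (OmegaMinus δ) (planeFold 1) 3 := by
  have hπ := pi_pos
  have foldAngle_one (θ : ℝ) : foldAngle 1 θ = π - 3 * θ := by
    rw [foldAngle]
    push_cast
    ring
  have h := isFolding_planeFold_sector (m := 1) (α := 0) (β := π / 4) hδ le_rfl (by linarith)
    (fun θ hθ => ?_) (fun θ hθ => ?_) (fun θ hθ hθ' => ?_) (fun θ hθ => ?_)
  · norm_num at h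
    exact h
  · by_contra hne
    exact hθ.2 ⟨hθ.1.2.1, hθ.1.1.2.lt_of_ne hne⟩
  · rw [foldAngle_one]
    exact ⟨by linarith [hθ.2], by linarith [hθ.1]⟩
  · rw [foldAngle_one] at hθ'
    linarith [hθ.2, hθ'.2]
  · have hθ' := hθ.2.2
    rw [foldAngle_one] at hθ'
    exact ⟨by linarith, by linarith [hθ.1.2]⟩

theorem sigma_of_mem_OmegaPlus {σp σm : ℝ} {x : Plane} (hx : x ∈ OmegaPlus δ) :
    sigma σp σm δ x = σp := if_pos hx

theorem sigma_of_mem_OmegaMinus {σp σm : ℝ} (hδ : 0 ≤ δ) {x : Plane} (hx : x ∈ OmegaMinus δ) :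
    sigma σp σm δ x = σm := by
  have hπ := pi_pos
  have hx_lt := ((mem_sector_iff hδ (by linarith) (by linarith)).1 hx).2.2
  refine (if_neg fun hxp => ?_).trans (if_pos hx)
  exact (((mem_sector_iff hδ (by linarith) le_rfl).1 hxp).2.1.trans hx_lt).false

theorem ae_mem_OmegaPlus_or_mem_OmegaMinus (hδ : 0 ≤ δ) :
    ∀ᵐ x ∂volume.restrict (Omega δ), x ∈ OmegaPlus δ ∨ x ∈ OmegaMinus δ := by
  have hπ := pi_pos
  filter_upwards [ae_restrict_mem (measurableSet_sector δ 0 π),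
    ae_restrict_of_ae (measure_eq_zero_iff_ae_notMem.1 volume_arg_eq_pi_div_four)] with x hx hne
  obtain ⟨hnorm, harg⟩ := (mem_Omega_iff hδ).1 hx
  rcases lt_or_gt_of_ne hne with hlt | hgt
  · exact Or.inr ((mem_sector_iff hδ (by linarith) (by linarith)).2 ⟨hnorm, harg.1, hlt⟩)
  · exact Or.inl ((mem_sector_iff hδ (by linarith) le_rfl).2 ⟨hnorm, hgt, harg.2⟩)

end SectorFolding

section Main

variable {σp σm : ℝ}

theorem norm_le_mul_norm_A_of_lt_neg (hσp : 0 < σp) (hσ : σp < -σm) {δ : ℝ} (hδ : 0 < δ)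
    (u : H10 (Omega δ)) : ‖u‖ ≤ foldConst 1 (-σm) σp * ‖A σp σm δ u‖ := by
  refine norm_le_mul_norm_A_of_isFolding (s := -1) (isOpen_Omega hδ.le) (isFolding_OmegaPlus hδ)
    (by simp) one_pos hσp (by rwa [one_mul]) ?_ ?_ u
  · exact .of_forall fun x hx => by rw [sigma_of_mem_OmegaPlus hx, neg_one_mul]
  · filter_upwards [ae_mem_OmegaPlus_or_mem_OmegaMinus hδ.le] with x hx hxU
    rw [sigma_of_mem_OmegaMinus hδ.le (hx.resolve_left hxU), neg_one_mul]

theorem norm_le_mul_norm_A_of_three_mul_neg_lt (hσm : σm < 0) (hσ : 3 * -σm < σp) {δ : ℝ}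
    (hδ : 0 < δ) (u : H10 (Omega δ)) : ‖u‖ ≤ foldConst 3 σp (-σm) * ‖A σp σm δ u‖ := by
  refine norm_le_mul_norm_A_of_isFolding (s := 1) (isOpen_Omega hδ.le) (isFolding_OmegaMinus hδ)
    (by simp) three_pos (neg_pos.2 hσm) hσ ?_ ?_ u
  · exact .of_forall fun x hx => by rw [sigma_of_mem_OmegaMinus hδ.le hx, one_mul, neg_neg]
  · filter_upwards [ae_mem_OmegaPlus_or_mem_OmegaMinus hδ.le] with x hx hxU
    rw [sigma_of_mem_OmegaPlus (hx.resolve_right hxU), one_mul]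

theorem exists_norm_le_mul_norm_A (hσp : 0 < σp) (hσm : σm < 0)
    (hκ : σm / σp ∈ Iio (-1 : ℝ) ∪ Ioo (-1 / 3 : ℝ) 0) :
    ∃ c : ℝ, 0 < c ∧ ∀ δ ∈ Ioo (0 : ℝ) 1, ∀ u : H10 (Omega δ), ‖u‖ ≤ c * ‖A σp σm δ u‖ := by
  rcases hκ with hκ | hκ
  · rw [mem_Iio, div_lt_iff₀ hσp] at hκ
    have hσ : σp < -σm := by linarith
    exact ⟨_, foldConst_pos one_pos hσp (by rwa [one_mul]),
      fun δ hδ => norm_le_mul_norm_A_of_lt_neg hσp hσ hδ.1⟩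
  · have hκ' := (lt_div_iff₀ hσp).1 hκ.1
    have hσ : 3 * -σm < σp := by linarith
    exact ⟨_, foldConst_pos three_pos (neg_pos.2 hσm) hσ,
      fun δ hδ => norm_le_mul_norm_A_of_three_mul_neg_lt hσm hσ hδ.1⟩

theorem A_apply_eq_conj (σp σm δ : ℝ) (u v : H10 (Omega δ)) :
    A σp σm δ u v = starRingEnd ℂ (A σp σm δ v u) := by
  rw [A_apply, A_apply, ← integral_conj]
  refine integral_congr_ae (.of_forall fun x => ?_)
  simp

end Main

end HalfAnnulus

end

theorem proposition7p1 (σp σm : ℝ) (hσp : 0 < σp) (hσm : σm < 0)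
    (hκ : σm / σp ∈ Set.Iio (-1 : ℝ) ∪ Set.Ioo (-1 / 3 : ℝ) 0) :
    (∀ δ ∈ Set.Ioo (0 : ℝ) 1,
      ∃ e : HalfAnnulus.H10 (HalfAnnulus.Omega δ) ≃L[ℂ]
          HalfAnnulus.Hneg1 (HalfAnnulus.Omega δ),
        ∀ u, e u = HalfAnnulus.A σp σm δ u) ∧
    ∃ c : ℝ, 0 < c ∧ ∀ δ ∈ Set.Ioo (0 : ℝ) 1,
      ∀ u : HalfAnnulus.H10 (HalfAnnulus.Omega δ),
        ‖u‖ ≤ c * ‖HalfAnnulus.A σp σm δ u‖ := by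
  obtain ⟨c, hc, hbound⟩ := HalfAnnulus.exists_norm_le_mul_norm_A hσp hσm hκ
  refine ⟨fun δ hδ => ?_, c, hc, hbound⟩
  have hΩ := HalfAnnulus.volume_Omega_ne_top hδ.1.le
  have := HalfAnnulus.completeSpace_range_gradient hΩ
  exact HalfAnnulus.exists_continuousLinearEquiv_of_hermitian (HalfAnnulus.H10.equivRange hΩ) _
    (HalfAnnulus.A_apply_eq_conj σp σm δ) (hbound δ hδ)
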